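/- Let $N\ge 1$ be an integer and let $\sigma\ge 1$ be real, with $\sigma<\frac{4}{N-2}$ if $N\ge 3$. For $\alpha>0$ let $B=(I-\alpha^2\Delta)^{-1}$ be the inverse of the Helmholtz operator on $\mathbb R^N$, that is, $u=B(g)$ is the solution of $u-\alpha^2\Delta u=g$ in the sense of tempered distributions, and for a complex-valued function $v$ on $\mathbb R^N$ put $f(v)=B(|v|^{\sigma+1})\,|v|^{\sigma-1}v$. Then there is a real number $r>2$, with $r\le\frac{2N}{N-2}$ if $N\ge 3$, depending only on $N$ and $\sigma$, such that the following holds, where $\frac1r+\frac1{r'}=1$. For every $\alpha>0$ and every $v\in H^1(\mathbb R^N)$ one has $v\in L^r(\mathbb R^N)$, the function $B(|v|^{\sigma+1})$ exists, and $f(v)\in L^{r'}(\mathbb R^N)$; moreover, for every $\alpha>0$ there is a constant $C_\alpha$ (depending only on $\alpha$, $N$, $\sigma$, $r$) such that for all $v_1,v_2\in H^1(\mathbb R^N)$ $$\|f(v_1)-f(v_2)\|_{L^{r'}}\le C_\alpha\left(\|v_1\|_{H^1}+\|v_2\|_{H^1}\right)^{2\sigma}\|v_1-v_2\|_{L^r}.$$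 Here $\|v\|_{H^1}^2=\|v\|_{L^2}^2+\|\nabla v\|_{L^2}^2$. -/

import Mathlib

open MeasureTheory FourierTransform TemperedDistribution
open scoped ENNReal NNReal SchwartzMap Laplacian

noncomputable section

/-- The squared Sobolev norm of `v ∈ L²(ℝᴺ)`,
`‖v‖²_{H¹} = ∫ (1 + |2πξ|²) |v̂(ξ)|² dξ`, as an element of `[0, ∞]`.  The Fourier transform is
`v̂(ξ) = ∫ e^{-2πi x·ξ} v(x) dx`, so that this is `‖v‖² + ‖∇v‖²`. -/
def h1NormSq {N : ℕ} (v : Lp ℂ 2 (volume : Measure (EuclideanSpace ℝ (Fin N)))) : ℝ≥0∞ :=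
  ∫⁻ ξ, ENNReal.ofReal (1 + (2 * Real.pi * ‖ξ‖) ^ 2) *
    ‖(𝓕 v : Lp ℂ 2 (volume : Measure (EuclideanSpace ℝ (Fin N)))) ξ‖ₑ ^ 2

/-- The Sobolev norm `‖v‖_{H¹}`. -/
def h1Norm {N : ℕ} (v : Lp ℂ 2 (volume : Measure (EuclideanSpace ℝ (Fin N)))) : ℝ≥0∞ :=
  h1NormSq v ^ (1 / 2 : ℝ)

/-- Membership of `v ∈ L²(ℝᴺ)` in the Sobolev space `H¹(ℝᴺ)`. -/
def MemH1 {N : ℕ} (v : Lp ℂ 2 (volume : Measure (EuclideanSpace ℝ (Fin N)))) : Prop :=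
  MemSobolev 1 2 (v : 𝓢'(EuclideanSpace ℝ (Fin N), ℂ))

/-- The tempered distribution `T` is (given by integration against) the function `g`. -/
def Represents {N : ℕ} (g : EuclideanSpace ℝ (Fin N) → ℂ)
    (T : 𝓢'(EuclideanSpace ℝ (Fin N), ℂ)) : Prop :=
  ∀ φ : 𝓢(EuclideanSpace ℝ (Fin N), ℂ),
    Integrable (fun x => φ x * g x) ∧ T φ = ∫ x, φ x * g x

/-- `u` solves the Helmholtz equation `u - α² Δu = g` on `ℝᴺ` in the sense of tempered
distributions. -/
def IsHelmholtzSolution {N : ℕ} (α : ℝ) (g u : EuclideanSpace ℝ (Fin N) → ℂ) : Prop :=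
  ∃ G U : 𝓢'(EuclideanSpace ℝ (Fin N), ℂ),
    Represents g G ∧ Represents u U ∧ U - ((α ^ 2 : ℝ) : ℂ) • Δ U = G

theorem Represents.locallyIntegrable {N : ℕ} {g : EuclideanSpace ℝ (Fin N) → ℂ}
    {T : 𝓢'(EuclideanSpace ℝ (Fin N), ℂ)} (hg : Represents g T) :
    LocallyIntegrable g volume := by
  intro x
  let b : ContDiffBump x := ⟨1, 2, one_pos, one_lt_two⟩
  have hc : HasCompactSupport (Complex.ofRealCLM ∘ (b : EuclideanSpace ℝ (Fin N) → ℝ)) :=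
    b.hasCompactSupport.comp_left rfl
  have hd : ContDiff ℝ ((⊤ : ℕ∞) : WithTop ℕ∞) (Complex.ofRealCLM ∘ (b : EuclideanSpace ℝ (Fin N) → ℝ)) :=
    Complex.ofRealCLM.contDiff.comp b.contDiff
  refine ⟨Metric.closedBall x 1, Metric.closedBall_mem_nhds x one_pos, ?_⟩
  refine ((hg (hc.toSchwartzMap hd)).1.integrableOn (s := Metric.closedBall x 1)).congr_fun
    ?_ Metric.isClosed_closedBall.measurableSet
  intro y hy
  have : b y = 1 := b.one_of_mem_closedBall hy
  simp [this]

/-- A distribution is given by at most one function, up to null sets. -/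
theorem Represents.ae_eq {N : ℕ} {g h : EuclideanSpace ℝ (Fin N) → ℂ}
    {T : 𝓢'(EuclideanSpace ℝ (Fin N), ℂ)} (hg : Represents g T) (hh : Represents h T) :
    g =ᵐ[volume] h := by
  refine ae_eq_of_integral_contDiff_smul_eq hg.locallyIntegrable hh.locallyIntegrable ?_
  intro b hb hbc
  have hc : HasCompactSupport (Complex.ofRealCLM ∘ b) := hbc.comp_left rfl
  have hd : ContDiff ℝ ((⊤ : ℕ∞) : WithTop ℕ∞) (Complex.ofRealCLM ∘ b) := Complex.ofRealCLM.contDiff.comp hb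
  have := (hg (hc.toSchwartzMap hd)).2.symm.trans (hh (hc.toSchwartzMap hd)).2
  simpa using this

theorem Represents.unique {N : ℕ} {g : EuclideanSpace ℝ (Fin N) → ℂ}
    {S T : 𝓢'(EuclideanSpace ℝ (Fin N), ℂ)} (hS : Represents g S) (hT : Represents g T) :
    S = T := by
  ext φ
  rw [(hS φ).2, (hT φ).2]

theorem helmholtz_eq_fourierMultiplierCLM {N : ℕ} (α : ℝ)
    (U : 𝓢'(EuclideanSpace ℝ (Fin N), ℂ)) :
    U - ((α ^ 2 : ℝ) : ℂ) • Δ U =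
      fourierMultiplierCLM ℂ (fun ξ => ((1 + α ^ 2 * (2 * Real.pi * ‖ξ‖) ^ 2 : ℝ) : ℂ)) U := by
  have hg : (fun ξ : EuclideanSpace ℝ (Fin N) =>
      Complex.ofReal (‖ξ‖ ^ 2)).HasTemperateGrowth := by fun_prop
  have hsum : (fun ξ : EuclideanSpace ℝ (Fin N) =>
        ((1 + α ^ 2 * (2 * Real.pi * ‖ξ‖) ^ 2 : ℝ) : ℂ)) =
      (fun _ => (1 : ℂ)) +
        ((α ^ 2 * (2 * Real.pi) ^ 2 : ℝ) : ℂ) • fun ξ => Complex.ofReal (‖ξ‖ ^ 2) := by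
    ext ξ
    simp only [Pi.add_apply, Pi.smul_apply, smul_eq_mul]
    push_cast
    ring
  have hg' : (((α ^ 2 * (2 * Real.pi) ^ 2 : ℝ) : ℂ) •
      fun ξ : EuclideanSpace ℝ (Fin N) => Complex.ofReal (‖ξ‖ ^ 2)).HasTemperateGrowth := by
    exact (Function.HasTemperateGrowth.const _).mul hg
  rw [hsum, fourierMultiplierCLM_apply, smulLeftCLM_add (by fun_prop) hg', smulLeftCLM_smul hg,
    laplacian_eq_fourierMultiplierCLM, fourierMultiplierCLM_apply]
  simp only [add_apply, smul_apply, smulLeftCLM_const, one_smul,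
    FourierTransform.fourierInv_add, FourierTransform.fourierInv_smul,
    FourierTransform.fourierInv_fourier_eq]
  rw [sub_eq_add_neg, ← Complex.coe_smul (-(2 * Real.pi) ^ 2), smul_smul, ← neg_smul]
  congr 2
  push_cast
  ring

theorem helmholtz_injective {N : ℕ} (α : ℝ) {U V : 𝓢'(EuclideanSpace ℝ (Fin N), ℂ)}
    (h : U - ((α ^ 2 : ℝ) : ℂ) • Δ U = V - ((α ^ 2 : ℝ) : ℂ) • Δ V) : U = V := by
  have h1 : (fun ξ : EuclideanSpace ℝ (Fin N) =>
      ((1 + α ^ 2 * (2 * Real.pi * ‖ξ‖) ^ 2 : ℝ) : ℂ)).HasTemperateGrowth := by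
    have : (fun ξ : EuclideanSpace ℝ (Fin N) =>
      ((1 + α ^ 2 * (2 * Real.pi * ‖ξ‖) ^ 2 : ℝ) : ℂ)) =
      fun ξ => ((1 + α ^ 2 * (2 * Real.pi) ^ 2 * ‖ξ‖ ^ 2 : ℝ) : ℂ) := by
      ext ξ; congr 1; ring
    rw [this]
    fun_prop
  have h2 : (fun ξ : EuclideanSpace ℝ (Fin N) =>
      (((1 + ‖(α * (2 * Real.pi)) • ξ‖ ^ 2) ^ (-1 : ℝ) : ℝ) : ℂ)).HasTemperateGrowth := by
    have h := Function.hasTemperateGrowth_one_add_norm_sq_rpow (EuclideanSpace ℝ (Fin N)) (-1)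
    have hl : (fun ξ : EuclideanSpace ℝ (Fin N) =>
        (α * (2 * Real.pi)) • ξ).HasTemperateGrowth := by fun_prop
    exact Complex.ofRealCLM.hasTemperateGrowth.comp (h.comp hl)
  rw [helmholtz_eq_fourierMultiplierCLM, helmholtz_eq_fourierMultiplierCLM] at h
  have h' := congrArg (fourierMultiplierCLM ℂ (fun ξ : EuclideanSpace ℝ (Fin N) =>
      (((1 + ‖(α * (2 * Real.pi)) • ξ‖ ^ 2) ^ (-1 : ℝ) : ℝ) : ℂ))) h
  rw [fourierMultiplierCLM_fourierMultiplierCLM_apply h1 h2,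
    fourierMultiplierCLM_fourierMultiplierCLM_apply h1 h2] at h'
  have h3 : ((fun ξ : EuclideanSpace ℝ (Fin N) =>
      ((1 + α ^ 2 * (2 * Real.pi * ‖ξ‖) ^ 2 : ℝ) : ℂ)) * fun ξ : EuclideanSpace ℝ (Fin N) =>
      (((1 + ‖(α * (2 * Real.pi)) • ξ‖ ^ 2) ^ (-1 : ℝ) : ℝ) : ℂ)) = fun _ => (1 : ℂ) := by
    ext ξ
    have : ‖(α * (2 * Real.pi)) • ξ‖ ^ 2 = α ^ 2 * (2 * Real.pi * ‖ξ‖) ^ 2 := by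
      rw [norm_smul, mul_pow, Real.norm_eq_abs, sq_abs]
      ring
    have hne : (1 + α ^ 2 * (2 * Real.pi * ‖ξ‖) ^ 2 : ℝ) ≠ 0 := by positivity
    rw [Pi.mul_apply, this, Real.rpow_neg_one, ← Complex.ofReal_mul, mul_inv_cancel₀ hne,
      Complex.ofReal_one]
  rw [h3] at h'
  simpa using h'

theorem represents_coe {N : ℕ} (v : Lp ℂ 2 (volume : Measure (EuclideanSpace ℝ (Fin N)))) :
    Represents v (v : 𝓢'(EuclideanSpace ℝ (Fin N), ℂ)) := by
  intro φ
  refine ⟨?_, by simp⟩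
  exact (φ.memLp 2 volume).integrable_mul (Lp.memLp v)

/-- The elements of `H¹` are exactly the functions in `L²` whose `H¹` norm is finite. -/
theorem memH1_iff {N : ℕ} (v : Lp ℂ 2 (volume : Measure (EuclideanSpace ℝ (Fin N)))) :
    MemH1 v ↔ h1Norm v < ∞ := by
  set w : Lp ℂ 2 (volume : Measure (EuclideanSpace ℝ (Fin N))) := 𝓕 v with hw
  set m : EuclideanSpace ℝ (Fin N) → ℂ := fun ξ => ((1 + ‖ξ‖ ^ 2) ^ ((1 : ℝ) / 2) : ℝ) with hm
  have hmT : m.HasTemperateGrowth := by rw [hm]; fun_prop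
  have hR : Represents (fun ξ => m ξ * w ξ)
      (smulLeftCLM ℂ m (𝓕 (v : 𝓢'(EuclideanSpace ℝ (Fin N), ℂ)))) := by
    intro φ
    have h := represents_coe w (SchwartzMap.smulLeftCLM ℂ m φ)
    rw [← Lp.fourier_toTemperedDistribution_eq v] at h
    have e : ∀ ξ, SchwartzMap.smulLeftCLM ℂ m φ ξ * w ξ = φ ξ * (m ξ * w ξ) := by
      intro ξ
      rw [SchwartzMap.smulLeftCLM_apply_apply hmT]
      simp only [smul_eq_mul]
      ring
    simp only [e] at h
    exact h
  have h1 : MemH1 v ↔ MemLp (fun ξ => m ξ * w ξ) 2 volume := by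
    rw [MemH1, memSobolev_iff_exists_smulLeftCLM_fourier]
    constructor
    · rintro ⟨f, hf⟩
      have : (f : EuclideanSpace ℝ (Fin N) → ℂ) =ᵐ[volume] fun ξ => m ξ * w ξ :=
        (represents_coe f).ae_eq (hf ▸ hR)
      exact (memLp_congr_ae this).1 (Lp.memLp f)
    · intro h
      refine ⟨h.toLp _, hR.unique ?_⟩
      intro φ
      have e : (fun ξ => φ ξ * (h.toLp _ : EuclideanSpace ℝ (Fin N) → ℂ) ξ) =ᵐ[volume] fun ξ => φ ξ * (m ξ * w ξ) := by
        filter_upwards [h.coeFn_toLp] with ξ hξ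
        rw [hξ]
      have := represents_coe (h.toLp _) φ
      rwa [integrable_congr e, integral_congr_ae e] at this
  have hmeas : AEStronglyMeasurable (fun ξ => m ξ * w ξ) volume :=
    hmT.1.continuous.aestronglyMeasurable.mul (Lp.aestronglyMeasurable w)
  have h2 : MemLp (fun ξ => m ξ * w ξ) 2 volume ↔
      ∫⁻ ξ, ENNReal.ofReal (1 + ‖ξ‖ ^ 2) * ‖w ξ‖ₑ ^ 2 < ∞ := by
    rw [MemLp, and_iff_right hmeas,
      eLpNorm_lt_top_iff_lintegral_rpow_enorm_lt_top (by norm_num) (by norm_num)]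
    have : ∀ ξ, ‖m ξ * w ξ‖ₑ ^ (2 : ℝ≥0∞).toReal = ENNReal.ofReal (1 + ‖ξ‖ ^ 2) * ‖w ξ‖ₑ ^ 2 := by
      intro ξ
      have hp : (0 : ℝ) ≤ 1 + ‖ξ‖ ^ 2 := by positivity
      rw [ENNReal.toReal_ofNat, ENNReal.rpow_ofNat, enorm_mul, mul_pow, ← ofReal_norm (m ξ),
        ← ENNReal.ofReal_pow (norm_nonneg _), hm]
      congr 2
      simp only [Complex.norm_real, Real.norm_eq_abs, sq_abs]
      rw [← Real.rpow_natCast, ← Real.rpow_mul hp]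
      norm_num
    simp only [this]
  have h3 : h1Norm v < ∞ ↔ h1NormSq v < ∞ := by
    rw [h1Norm, ENNReal.rpow_lt_top_iff_of_pos (by norm_num)]
  rw [h1, h2, h3, h1NormSq]
  have hpi : 1 ≤ 2 * Real.pi := by linarith [Real.pi_gt_three]
  constructor
  · intro h
    refine lt_of_le_of_lt ?_ (ENNReal.mul_lt_top (ENNReal.ofReal_lt_top
      (r := (2 * Real.pi) ^ 2)) h)
    rw [← lintegral_const_mul' _ _ ENNReal.ofReal_ne_top]
    refine lintegral_mono fun ξ => ?_
    rw [← mul_assoc, ← ENNReal.ofReal_mul (by positivity)]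
    gcongr
    nlinarith [sq_nonneg ‖ξ‖]
  · refine lt_of_le_of_lt (lintegral_mono fun ξ => ?_)
    gcongr
    nlinarith [norm_nonneg ξ]

/-- The Helmholtz equation determines its solution up to a null set. -/
theorem IsHelmholtzSolution.ae_eq {N : ℕ} {α : ℝ} {g u w : EuclideanSpace ℝ (Fin N) → ℂ}
    (hu : IsHelmholtzSolution α g u) (hw : IsHelmholtzSolution α g w) : u =ᵐ[volume] w := by
  obtain ⟨G, U, hG, hU, hGU⟩ := hu
  obtain ⟨G', W, hG', hW, hGW⟩ := hw
  obtain rfl := hG.unique hG'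
  obtain rfl := helmholtz_injective α (hGU.trans hGW.symm)
  exact hU.ae_eq hW

open Classical in
/-- The operator `B = (I - α² Δ)⁻¹`: `helmholtzInv α g` is the solution `u` of `u - α² Δu = g`, which
is unique up to a null set (and it is `0` if there is no solution). -/
def helmholtzInv {N : ℕ} (α : ℝ) (g : EuclideanSpace ℝ (Fin N) → ℂ) :
    EuclideanSpace ℝ (Fin N) → ℂ :=
  if h : ∃ u, IsHelmholtzSolution α g u then h.choose else 0

/-- The function `|v|^{σ+1}`. -/
def source {N : ℕ} (σ : ℝ) (v : EuclideanSpace ℝ (Fin N) → ℂ) : EuclideanSpace ℝ (Fin N) → ℂ :=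
  fun x => ((‖v x‖ ^ (σ + 1) : ℝ) : ℂ)

/-- The nonlinearity `f(v) = B(|v|^{σ+1}) |v|^{σ-1} v`. -/
def nonlinearity {N : ℕ} (α σ : ℝ) (v : EuclideanSpace ℝ (Fin N) → ℂ) :
    EuclideanSpace ℝ (Fin N) → ℂ :=
  fun x => helmholtzInv α (source σ v) x * ((‖v x‖ ^ (σ - 1) : ℝ) : ℂ) * v x

end

/-! The operator B is convolution with the positive kernel K obtained by integrating e^{-t} times
the heat kernel at time α²t over t > 0. Its Fourier transform is the inverse symbol
(`fourier_helmholtzKernel`), so convolution with K solves the equation distributionally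
(`isHelmholtzSolution_helmholtzConv`), and uniqueness identifies it a.e. with `helmholtzInv`. Since
K lies in Lˢ for s > 1 with (N-2)s < N (`lintegral_helmholtzKernel_rpow_lt_top`), Young's inequality
(`lintegral_lintegral_mul_rpow_le`) bounds B from Lᵖ to the conjugate L^q whenever q > 2 and (N-2)q
< 2N.

If v is in Lʳ, then |v|^{σ+1} is in Lᵖ with p = r/(σ+1), its image under B is in L^q, and
multiplication by |v|^σ lands in L^{r'} because 1/q + σ/r = 1 - 1/r. Differences obey the same count
once one factor v is replaced by v₁ - v₂, by elementary inequalities for powers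
(`exists_eLpNorm_nonlinearity_sub_le`).

The passage from Lʳ to H¹ uses the same kernel with α = 1. By duality it suffices to bound the
square of the H⁻¹ norm of f; writing 1/(1 + |2πξ|²) as an integral of Gaussians bounds it by ∫ |f|
(K * |f|), which Hölder and Young control by the square of the L^{r'} norm
(`exists_eLpNorm_le_h1Norm`). An exponent r meeting all constraints exists because σ(N-2) < 4
(`exists_admissibleExponent`). -/

/-! ### Heat kernels: Fourier transforms and Lˢ integrals. -/

section HeatKernel

variable {V : Type*} [NormedAddCommGroup V] [InnerProductSpace ℝ V]

/-- The heat kernel at time `a`. -/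
noncomputable def heatKernel (a : ℝ) (z : V) : ℝ :=
  (4 * Real.pi * a) ^ (-(Module.finrank ℝ V / 2 : ℝ)) * Real.exp (-(1 / (4 * a)) * ‖z‖ ^ 2)

theorem heatKernel_nonneg {a : ℝ} (ha : 0 ≤ a) (z : V) : 0 ≤ heatKernel a z := by
  unfold heatKernel
  positivity

variable [MeasurableSpace V] [BorelSpace V]

@[fun_prop]
theorem measurable_heatKernel : Measurable (fun p : ℝ × V => heatKernel p.1 p.2) := by
  unfold heatKernel
  fun_prop

variable [FiniteDimensional ℝ V]

/-- The Fourier transform of a Gaussian is a heat kernel. -/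
theorem fourier_gaussian_eq_heatKernel {a : ℝ} (ha : 0 < a) (z : V) :
    𝓕 (fun ξ : V => ((Real.exp (-(4 * Real.pi ^ 2 * a) * ‖ξ‖ ^ 2) : ℝ) : ℂ)) z =
      (heatKernel a z : ℂ) := by
  have hb : 0 < ((4 * Real.pi ^ 2 * a : ℝ) : ℂ).re := by
    rw [Complex.ofReal_re]; positivity
  have h := fourier_gaussian_innerProductSpace hb z
  have e : (fun ξ : V => ((Real.exp (-(4 * Real.pi ^ 2 * a) * ‖ξ‖ ^ 2) : ℝ) : ℂ)) =
      fun ξ => Complex.exp (-((4 * Real.pi ^ 2 * a : ℝ) : ℂ) * ‖ξ‖ ^ 2) := by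
    ext ξ; push_cast; rfl
  rw [e, h, heatKernel]
  have hbase : (4 * Real.pi * a) ^ (-(Module.finrank ℝ V / 2 : ℝ)) =
      (Real.pi / (4 * Real.pi ^ 2 * a)) ^ (Module.finrank ℝ V / 2 : ℝ) := by
    rw [Real.rpow_neg (by positivity), ← Real.inv_rpow (by positivity)]
    congr 1
    field_simp
  rw [hbase]
  push_cast [Complex.ofReal_cpow (show 0 ≤ Real.pi / (4 * Real.pi ^ 2 * a) by positivity)]
  congr 2
  have : (Real.pi : ℂ) ≠ 0 := by exact_mod_cast Real.pi_ne_zero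
  have : (a : ℂ) ≠ 0 := by exact_mod_cast ha.ne'
  field_simp

/-- The Fourier transform of a heat kernel is a Gaussian. -/
theorem fourier_heatKernel {a : ℝ} (ha : 0 < a) (ξ : V) :
    𝓕 (fun z : V => (heatKernel a z : ℂ)) ξ =
      ((Real.exp (-(4 * Real.pi ^ 2 * a) * ‖ξ‖ ^ 2) : ℝ) : ℂ) := by
  have hb : 0 < ((1 / (4 * a) : ℝ) : ℂ).re := by
    rw [Complex.ofReal_re]; positivity
  have h := fourier_gaussian_innerProductSpace hb ξ
  have e : (fun z : V => (heatKernel a z : ℂ)) =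
      (((4 * Real.pi * a) ^ (-(Module.finrank ℝ V / 2 : ℝ)) : ℝ) : ℂ) •
        fun z => Complex.exp (-((1 / (4 * a) : ℝ) : ℂ) * ‖z‖ ^ 2) := by
    ext z
    simp only [Pi.smul_apply, smul_eq_mul, heatKernel]
    push_cast
    rfl
  have hs (c : ℂ) (f : V → ℂ) : 𝓕 (c • f) ξ = c * 𝓕 f ξ := by
    simp only [Real.fourier_eq, Pi.smul_apply, smul_comm _ c]
    rw [integral_smul, smul_eq_mul]
  rw [e, hs, h, ← mul_assoc]
  have hbase : (((4 * Real.pi * a) ^ (-(Module.finrank ℝ V / 2 : ℝ)) : ℝ) : ℂ) *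
      (Real.pi / ((1 / (4 * a) : ℝ) : ℂ)) ^ (Module.finrank ℝ V / 2 : ℂ) = 1 := by
    have : (Real.pi / ((1 / (4 * a) : ℝ) : ℂ)) ^ (Module.finrank ℝ V / 2 : ℂ) =
        (((4 * Real.pi * a) ^ (Module.finrank ℝ V / 2 : ℝ) : ℝ) : ℂ) := by
      rw [Complex.ofReal_cpow (by positivity)]
      push_cast
      congr 1
      field_simp
    rw [this, ← Complex.ofReal_mul, ← Real.rpow_add (by positivity)]
    simp
  rw [hbase, one_mul]
  push_cast
  congr 1
  have : (a : ℂ) ≠ 0 := by exact_mod_cast ha.ne'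
  field_simp

theorem integrable_exp_neg_mul_sq_norm {b : ℝ} (hb : 0 < b) :
    Integrable (fun v : V => Real.exp (-b * ‖v‖ ^ 2)) := by
  have h := GaussianFourier.integrable_cexp_neg_mul_sq_norm_add
    (show 0 < (b : ℂ).re from hb) 0 (0 : V)
  refine h.norm.congr (ae_of_all _ fun v => ?_)
  have : (-(b : ℂ) * (‖v‖ : ℂ) ^ 2 + 0 * (inner ℝ (0 : V) v : ℂ)) = ((-b * ‖v‖ ^ 2 : ℝ) : ℂ) := by
    push_cast; ring
  simp only [this, Complex.norm_exp, Complex.ofReal_re]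

/-- A power of a Gaussian is a Gaussian. The exponent of `a`, namely -(d/2)(s - 1), governs how
singular the Helmholtz kernel is in Lˢ as the time tends to 0. -/
theorem lintegral_heatKernel_rpow {a s : ℝ} (ha : 0 < a) (hs : 0 < s) :
    ∫⁻ z : V, ENNReal.ofReal (heatKernel a z) ^ s =
      ENNReal.ofReal ((4 * Real.pi * a) ^ (-(Module.finrank ℝ V / 2 : ℝ) * (s - 1)) *
        s ^ (-(Module.finrank ℝ V / 2 : ℝ))) := by
  set d : ℝ := Module.finrank ℝ V / 2 with hd
  have hb : 0 < s / (4 * a) := by positivity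
  have e : ∀ z : V, ENNReal.ofReal (heatKernel a z) ^ s =
      ENNReal.ofReal ((4 * Real.pi * a) ^ (-d * s) * Real.exp (-(s / (4 * a)) * ‖z‖ ^ 2)) := by
    intro z
    rw [ENNReal.ofReal_rpow_of_nonneg (heatKernel_nonneg ha.le z) hs.le, heatKernel,
      Real.mul_rpow (by positivity) (by positivity), ← Real.rpow_mul (by positivity),
      ← Real.exp_mul]
    congr 3
    ring
  simp_rw [e]
  rw [← ofReal_integral_eq_lintegral_ofReal ((integrable_exp_neg_mul_sq_norm hb).const_mul _)
    (ae_of_all _ fun z => by positivity), integral_const_mul,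
    GaussianFourier.integral_rexp_neg_mul_sq_norm hb]
  congr 1
  have : Real.pi / (s / (4 * a)) = (4 * Real.pi * a) / s := by field_simp
  rw [this, Real.div_rpow (by positivity) hs.le, Real.rpow_neg hs.le, mul_div_assoc', ← hd,
    ← Real.rpow_add (by positivity), div_eq_mul_inv]
  congr 2
  ring

end HeatKernel

/-! ### The Helmholtz kernel: total mass and integrability. -/

section HelmholtzKernel

variable {V : Type*} [NormedAddCommGroup V] [InnerProductSpace ℝ V]

/-- The fundamental solution of `I - α² Δ`. -/
noncomputable def helmholtzKernel (α : ℝ) (z : V) : ℝ≥0∞ :=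
  ∫⁻ t in Set.Ioi (0 : ℝ), ENNReal.ofReal (Real.exp (-t) * heatKernel (α ^ 2 * t) z)

variable [MeasurableSpace V] [BorelSpace V]

theorem measurable_exp_mul_heatKernel (α : ℝ) :
    Measurable (fun p : V × ℝ => Real.exp (-p.2) * heatKernel (α ^ 2 * p.2) p.1) := by
  have : Measurable (fun p : V × ℝ => heatKernel (α ^ 2 * p.2) p.1) :=
    measurable_heatKernel.comp (f := fun p : V × ℝ => (α ^ 2 * p.2, p.1)) (by fun_prop)
  fun_prop

@[fun_prop]
theorem measurable_helmholtzKernel (α : ℝ) : Measurable (helmholtzKernel α : V → ℝ≥0∞) := by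
  unfold helmholtzKernel
  exact (measurable_exp_mul_heatKernel α).ennreal_ofReal.lintegral_prod_right'

theorem lintegral_exp_neg_mul_Ioi {c : ℝ} (hc : 0 < c) :
    ∫⁻ t in Set.Ioi (0 : ℝ), ENNReal.ofReal (Real.exp (-c * t)) = ENNReal.ofReal (1 / c) := by
  rw [← ofReal_integral_eq_lintegral_ofReal (integrableOn_exp_mul_Ioi (neg_lt_zero.2 hc) 0)
    (ae_of_all _ fun z => by positivity), integral_exp_mul_Ioi (neg_lt_zero.2 hc) 0]
  simp

variable [FiniteDimensional ℝ V]

theorem lintegral_lintegral_exp_mul_heatKernel {α : ℝ} (hα : 0 < α) :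
    ∫⁻ t in Set.Ioi (0 : ℝ), ∫⁻ z : V,
      ENNReal.ofReal (Real.exp (-t) * heatKernel (α ^ 2 * t) z) = 1 := by
  have h : ∀ t ∈ Set.Ioi (0 : ℝ), ∫⁻ z : V,
      ENNReal.ofReal (Real.exp (-t) * heatKernel (α ^ 2 * t) z) =
        ENNReal.ofReal (Real.exp (-1 * t)) := by
    intro t ht
    have ha : 0 < α ^ 2 * t := mul_pos (by positivity) ht
    have := lintegral_heatKernel_rpow (V := V) ha one_pos
    simp only [ENNReal.rpow_one, sub_self, mul_zero, Real.rpow_zero, Real.one_rpow, mul_one,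
      ENNReal.ofReal_one] at this
    simp_rw [ENNReal.ofReal_mul (Real.exp_pos (-t)).le]
    rw [lintegral_const_mul' _ _ ENNReal.ofReal_ne_top, this]
    simp
  rw [setLIntegral_congr_fun measurableSet_Ioi h, lintegral_exp_neg_mul_Ioi one_pos]
  simp

theorem lintegral_helmholtzKernel {α : ℝ} (hα : 0 < α) :
    ∫⁻ z : V, helmholtzKernel α z = 1 := by
  unfold helmholtzKernel
  rw [lintegral_lintegral_swap (measurable_exp_mul_heatKernel α).ennreal_ofReal.aemeasurable,
    lintegral_lintegral_exp_mul_heatKernel hα]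

theorem lintegral_exp_neg_mul_rpow_lt_top {c : ℝ} (hc : -1 < c) :
    ∫⁻ t in Set.Ioi (0 : ℝ), ENNReal.ofReal (Real.exp (-t) * t ^ c) < ∞ := by
  have h := Real.GammaIntegral_convergent (s := c + 1) (by linarith)
  rw [add_sub_cancel_right] at h
  exact h.lintegral_lt_top

/-- The fundamental solution lies in `Lˢ` below the critical exponent `d / (d - 2)`. -/
theorem lintegral_helmholtzKernel_rpow_lt_top {α s : ℝ} (hα : 0 < α) (hs : 1 < s)
    (hsd : ((Module.finrank ℝ V : ℝ) - 2) * s < Module.finrank ℝ V) :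
    ∫⁻ z : V, helmholtzKernel α z ^ s < ∞ := by
  set d : ℝ := (Module.finrank ℝ V : ℝ) with hd
  have hs1 : 0 < s - 1 := by linarith
  have hs0 : 0 < s := by linarith
  -- The weight e⁻ᵗ t⁻ᵇ is integrable if b < 1; the time integral left after Hölder converges if (s
  -- - 1)(b - d/2) > -1, which is the lower bound on b. The interval is nonempty exactly when (d -
  -- 2)s < d.
  obtain ⟨b, hb1, hb2⟩ : ∃ b, d / 2 - 1 / (s - 1) < b ∧ b < 1 := by
    apply exists_between
    rw [sub_lt_iff_lt_add, ← sub_lt_iff_lt_add', lt_div_iff₀ hs1]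
    linarith
  have hc : -1 < (s - 1) * (b - d / 2) := by
    have : -(1 / (s - 1)) < b - d / 2 := by linarith
    have := mul_lt_mul_of_pos_left this hs1
    rwa [mul_neg, mul_one_div_cancel hs1.ne'] at this
  -- Hölder's inequality against the weight `e⁻ᵗ t⁻ᵇ`
  set A : ℝ≥0∞ := ∫⁻ t in Set.Ioi (0 : ℝ), ENNReal.ofReal (Real.exp (-t) * t ^ (-b)) with hA
  have hAtop : A < ∞ := lintegral_exp_neg_mul_rpow_lt_top (by linarith)
  have key : ∀ z : V, helmholtzKernel α z ^ s ≤ A ^ (s - 1) *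
      ∫⁻ t in Set.Ioi (0 : ℝ), ENNReal.ofReal (Real.exp (-t) * t ^ ((s - 1) * b)) *
        ENNReal.ofReal (heatKernel (α ^ 2 * t) z) ^ s := by
    intro z
    have hm : Measurable fun t : ℝ => heatKernel (α ^ 2 * t) z :=
      measurable_heatKernel.comp (f := fun t : ℝ => (α ^ 2 * t, z)) (by fun_prop)
    have h := ENNReal.lintegral_mul_norm_pow_le (μ := volume.restrict (Set.Ioi (0 : ℝ)))
      (f := fun t => ENNReal.ofReal (Real.exp (-t) * t ^ (-b)))
      (g := fun t => ENNReal.ofReal (Real.exp (-t) * t ^ ((s - 1) * b)) *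
        ENNReal.ofReal (heatKernel (α ^ 2 * t) z) ^ s)
      (by fun_prop) (by fun_prop) (p := 1 - 1 / s) (q := 1 / s)
      (by rw [sub_nonneg, div_le_one hs0]; exact hs.le) (by positivity) (by ring)
    have e : ∀ t ∈ Set.Ioi (0 : ℝ),
        ENNReal.ofReal (Real.exp (-t) * t ^ (-b)) ^ (1 - 1 / s) *
          (ENNReal.ofReal (Real.exp (-t) * t ^ ((s - 1) * b)) *
            ENNReal.ofReal (heatKernel (α ^ 2 * t) z) ^ s) ^ (1 / s) =
        ENNReal.ofReal (Real.exp (-t) * heatKernel (α ^ 2 * t) z) := by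
      intro t ht
      have ht : 0 < t := ht
      have hk : 0 ≤ heatKernel (α ^ 2 * t) z := heatKernel_nonneg (by positivity) z
      have hq : 0 ≤ 1 - 1 / s := by rw [sub_nonneg, div_le_one hs0]; exact hs.le
      rw [ENNReal.ofReal_rpow_of_nonneg hk hs0.le, ← ENNReal.ofReal_mul (by positivity),
        ENNReal.ofReal_rpow_of_nonneg (by positivity) hq,
        ENNReal.ofReal_rpow_of_nonneg (by positivity) (by positivity),
        ← ENNReal.ofReal_mul (by positivity)]
      congr 1
      rw [Real.mul_rpow (by positivity) (by positivity), Real.mul_rpow (by positivity)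
        (by positivity), Real.mul_rpow (by positivity) (by positivity), ← Real.rpow_mul hk,
        mul_one_div_cancel hs0.ne', Real.rpow_one, ← Real.rpow_mul ht.le, ← Real.rpow_mul ht.le,
        ← Real.exp_mul, ← Real.exp_mul]
      have e1 : Real.exp (-t * (1 - 1 / s)) * Real.exp (-t * (1 / s)) = Real.exp (-t) := by
        rw [← Real.exp_add]; congr 1; ring
      have e2 : t ^ (-b * (1 - 1 / s)) * t ^ ((s - 1) * b * (1 / s)) = 1 := by
        rw [← Real.rpow_add ht]
        convert! Real.rpow_zero t using 2
        field_simp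
        ring
      calc _ = (Real.exp (-t * (1 - 1 / s)) * Real.exp (-t * (1 / s))) *
            (t ^ (-b * (1 - 1 / s)) * t ^ ((s - 1) * b * (1 / s))) *
              heatKernel (α ^ 2 * t) z := by ring
        _ = _ := by rw [e1, e2, mul_one]
    rw [setLIntegral_congr_fun measurableSet_Ioi e] at h
    refine (ENNReal.rpow_le_rpow h hs0.le).trans_eq ?_
    rw [ENNReal.mul_rpow_of_nonneg _ _ hs0.le, ← ENNReal.rpow_mul, ← ENNReal.rpow_mul,
      one_div_mul_cancel hs0.ne', ENNReal.rpow_one]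
    congr 2
    field_simp
  refine (lintegral_mono key).trans_lt ?_
  rw [lintegral_const_mul' _ _ (ENNReal.rpow_lt_top_of_nonneg hs1.le hAtop.ne).ne]
  refine ENNReal.mul_lt_top (ENNReal.rpow_lt_top_of_nonneg hs1.le hAtop.ne) ?_
  have hm : Measurable (fun p : V × ℝ => heatKernel (α ^ 2 * p.2) p.1) :=
    measurable_heatKernel.comp (f := fun p : V × ℝ => (α ^ 2 * p.2, p.1)) (by fun_prop)
  rw [lintegral_lintegral_swap (by fun_prop)]
  have e : ∀ t ∈ Set.Ioi (0 : ℝ),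
      ∫⁻ z : V, ENNReal.ofReal (Real.exp (-t) * t ^ ((s - 1) * b)) *
        ENNReal.ofReal (heatKernel (α ^ 2 * t) z) ^ s =
      ENNReal.ofReal ((4 * Real.pi * α ^ 2) ^ (-(d / 2) * (s - 1)) * s ^ (-(d / 2))) *
        ENNReal.ofReal (Real.exp (-t) * t ^ ((s - 1) * (b - d / 2))) := by
    intro t ht
    have ht : 0 < t := ht
    rw [lintegral_const_mul' _ _ ENNReal.ofReal_ne_top,
      lintegral_heatKernel_rpow (by positivity) hs0, ← ENNReal.ofReal_mul (by positivity),
      ← ENNReal.ofReal_mul (by positivity), ← hd, ← mul_assoc (4 * Real.pi),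
      Real.mul_rpow (by positivity) ht.le]
    have : t ^ ((s - 1) * (b - d / 2)) = t ^ ((s - 1) * b) * t ^ (-(d / 2) * (s - 1)) := by
      rw [← Real.rpow_add ht]
      congr 1
      ring
    rw [this]
    congr 1
    ring
  rw [setLIntegral_congr_fun measurableSet_Ioi e, lintegral_const_mul' _ _ ENNReal.ofReal_ne_top]
  exact ENNReal.mul_lt_top ENNReal.ofReal_lt_top (lintegral_exp_neg_mul_rpow_lt_top hc)

end HelmholtzKernel

/-- Hölder's inequality for three functions. -/
theorem lintegral_mul_mul_norm_pow_le {X : Type*} [MeasurableSpace X] {μ : Measure X}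
    {f g h : X → ℝ≥0∞} (hf : AEMeasurable f μ) (hg : AEMeasurable g μ) (hh : AEMeasurable h μ)
    {a b c : ℝ} (ha : 0 ≤ a) (hb : 0 ≤ b) (hc : 0 ≤ c) (habc : a + b + c = 1) :
    ∫⁻ x, f x ^ a * g x ^ b * h x ^ c ∂μ ≤
      (∫⁻ x, f x ∂μ) ^ a * (∫⁻ x, g x ∂μ) ^ b * (∫⁻ x, h x ∂μ) ^ c := by
  have := ENNReal.lintegral_prod_norm_pow_le (μ := μ) Finset.univ (f := ![f, g, h])
    (p := ![a, b, c]) (by simp [Fin.forall_fin_succ, hf, hg, hh])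
    (by simp [Fin.sum_univ_succ, ← habc, add_assoc]) (by simp [Fin.forall_fin_succ, ha, hb, hc])
  simpa [Fin.prod_univ_succ, mul_assoc] using this

/-! ### Young's inequality by Hölder with three factors. -/

section Young

variable {V : Type*} [NormedAddCommGroup V] [MeasurableSpace V] [BorelSpace V]
  [SecondCountableTopology V] {μ : Measure V} [SFinite μ] [μ.IsAddLeftInvariant] [μ.IsNegInvariant]

/-- Young's convolution inequality between conjugate exponents. -/
theorem lintegral_lintegral_mul_rpow_le {K f : V → ℝ≥0∞} (hK : Measurable K) (hf : Measurable f)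
    {p q : ℝ} (hpq : p.HolderConjugate q) (hq : 2 ≤ q) :
    ∫⁻ x, (∫⁻ y, K (x - y) * f y ∂μ) ^ q ∂μ ≤
      (∫⁻ z, K z ^ (q / 2) ∂μ) ^ 2 * (∫⁻ y, f y ^ p ∂μ) ^ (q - 1) := by
  have hq0 : 0 < q := by linarith
  have hp0 : 0 < p := hpq.pos
  have hinv : p⁻¹ + q⁻¹ = 1 := hpq.inv_add_inv_eq_one
  have h2q : 0 ≤ 1 - 2 / q := by rw [sub_nonneg, div_le_one hq0]; exact hq
  set A := ∫⁻ z, K z ^ (q / 2) ∂μ with hA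
  set F := ∫⁻ y, f y ^ p ∂μ with hF
  have key : ∀ x, (∫⁻ y, K (x - y) * f y ∂μ) ^ q ≤
      (A * F ^ (q - 2)) * ∫⁻ y, K (x - y) ^ (q / 2) * f y ^ p ∂μ := by
    intro x
    -- Kf is split as (K^{q/2} fᵖ)^{1/q} · (K^{q/2})^{1/q} · (fᵖ)^{1-2/q}. Conjugacy of p and q
    -- makes the powers of f add up to 1, and q ≥ 2 makes the last exponent nonnegative. Only the
    -- first factor couples x and y after integration in y.
    have h := lintegral_mul_mul_norm_pow_le (μ := μ)
      (f := fun y => K (x - y) ^ (q / 2) * f y ^ p) (g := fun y => K (x - y) ^ (q / 2))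
      (h := fun y => f y ^ p) (a := 1 / q) (b := 1 / q) (c := 1 - 2 / q)
      (by fun_prop) (by fun_prop) (by fun_prop) (by positivity) (by positivity) h2q (by ring)
    have e : ∀ y, (K (x - y) ^ (q / 2) * f y ^ p) ^ (1 / q) * (K (x - y) ^ (q / 2)) ^ (1 / q) *
        (f y ^ p) ^ (1 - 2 / q) = K (x - y) * f y := by
      intro y
      rw [ENNReal.mul_rpow_of_nonneg _ _ (by positivity), ← ENNReal.rpow_mul, ← ENNReal.rpow_mul,
        ← ENNReal.rpow_mul]
      have e1 : K (x - y) ^ (q / 2 * (1 / q)) * K (x - y) ^ (q / 2 * (1 / q)) = K (x - y) := by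
        rw [← ENNReal.rpow_add_of_nonneg _ _ (by positivity) (by positivity)]
        convert! ENNReal.rpow_one _ using 2
        field_simp
        norm_num
      have e2 : f y ^ (p * (1 / q)) * f y ^ (p * (1 - 2 / q)) = f y := by
        rw [← ENNReal.rpow_add_of_nonneg _ _ (by positivity) (by positivity)]
        convert! ENNReal.rpow_one _ using 2
        have : q⁻¹ = 1 - p⁻¹ := by linarith
        rw [one_div, div_eq_mul_inv, this]
        field_simp
        ring
      calc _ = (K (x - y) ^ (q / 2 * (1 / q)) * K (x - y) ^ (q / 2 * (1 / q))) *
            (f y ^ (p * (1 / q)) * f y ^ (p * (1 - 2 / q))) := by ring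
        _ = _ := by rw [e1, e2]
    simp_rw [e] at h
    have hKx : ∫⁻ y, K (x - y) ^ (q / 2) ∂μ = A :=
      lintegral_sub_left_eq_self (fun z => K z ^ (q / 2)) x
    rw [hKx] at h
    refine (ENNReal.rpow_le_rpow h hq0.le).trans_eq ?_
    rw [ENNReal.mul_rpow_of_nonneg _ _ hq0.le, ENNReal.mul_rpow_of_nonneg _ _ hq0.le,
      ← ENNReal.rpow_mul, ← ENNReal.rpow_mul, ← ENNReal.rpow_mul, one_div_mul_cancel hq0.ne',
      ENNReal.rpow_one, ENNReal.rpow_one]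
    have : (1 - 2 / q) * q = q - 2 := by field_simp
    rw [this]
    ring
  refine (lintegral_mono key).trans_eq ?_
  rw [lintegral_const_mul _ (by fun_prop), lintegral_lintegral_swap (by fun_prop)]
  have e : ∀ y, ∫⁻ x, K (x - y) ^ (q / 2) * f y ^ p ∂μ = A * f y ^ p := by
    intro y
    rw [lintegral_mul_const _ (by fun_prop), lintegral_sub_right_eq_self (fun z => K z ^ (q / 2)) y]
  simp_rw [e]
  rw [lintegral_const_mul _ (by fun_prop), ← hF]
  have : F ^ (q - 1) = F ^ (q - 2) * F := by
    have := ENNReal.rpow_add_of_nonneg (x := F) (q - 2) 1 (by linarith) one_pos.le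
    rw [ENNReal.rpow_one] at this
    rw [← this]
    congr 1
    ring
  rw [this]
  ring

end Young

/-! ### The Helmholtz kernel on the Fourier side. -/

section Fourier

theorem toReal_helmholtzKernel {V : Type*} [NormedAddCommGroup V] [InnerProductSpace ℝ V]
    [MeasurableSpace V] [BorelSpace V] (α : ℝ) (z : V) :
    (helmholtzKernel α z).toReal =
      ∫ t in Set.Ioi (0 : ℝ), Real.exp (-t) * heatKernel (α ^ 2 * t) z := by
  rw [integral_eq_lintegral_of_nonneg_ae]
  · rfl
  · filter_upwards [self_mem_ae_restrict measurableSet_Ioi] with t ht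
    have : 0 ≤ heatKernel (α ^ 2 * t) z :=
      heatKernel_nonneg (mul_nonneg (sq_nonneg α) (le_of_lt ht)) z
    simp only [Pi.zero_apply]
    positivity
  · exact ((measurable_exp_mul_heatKernel (V := V) α).comp
      (measurable_const.prodMk measurable_id)).aestronglyMeasurable

variable {V : Type*} [NormedAddCommGroup V] [InnerProductSpace ℝ V] [FiniteDimensional ℝ V]
  [MeasurableSpace V] [BorelSpace V]

theorem integral_fourier_mul_eq_integral_mul_fourier {f g : V → ℂ} (hf : Integrable f)
    (hg : Integrable g) : ∫ ξ, 𝓕 f ξ * g ξ = ∫ x, f x * 𝓕 g x := by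
  have := VectorFourier.integral_fourierIntegral_smul_eq_flip (L := innerₗ V)
    Real.continuous_fourierChar continuous_inner hf hg
  rw [flip_innerₗ] at this
  exact this

theorem integrable_exp_mul_heatKernel {α : ℝ} (hα : 0 < α) :
    Integrable (fun p : V × ℝ => Real.exp (-p.2) * heatKernel (α ^ 2 * p.2) p.1)
      (volume.prod (volume.restrict (Set.Ioi 0))) := by
  refine ⟨(measurable_exp_mul_heatKernel α).aestronglyMeasurable, ?_⟩
  rw [hasFiniteIntegral_iff_enorm, lintegral_prod _
    (measurable_exp_mul_heatKernel α).enorm.aemeasurable]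
  refine lt_of_eq_of_lt ?_ ENNReal.one_lt_top
  rw [← lintegral_helmholtzKernel (V := V) hα]
  refine lintegral_congr fun z => setLIntegral_congr_fun measurableSet_Ioi fun t ht => ?_
  have : 0 ≤ heatKernel (α ^ 2 * t) z :=
    heatKernel_nonneg (mul_nonneg (sq_nonneg α) (le_of_lt ht)) z
  exact Real.enorm_of_nonneg (by positivity)

theorem integrable_toReal_helmholtzKernel {α : ℝ} (hα : 0 < α) :
    Integrable (fun z : V => (helmholtzKernel α z).toReal) :=
  integrable_toReal_of_lintegral_ne_top (measurable_helmholtzKernel α).aemeasurable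
    (by rw [lintegral_helmholtzKernel hα]; exact ENNReal.one_ne_top)

/-- The Fourier transform of the fundamental solution is the inverse of the Helmholtz symbol. -/
theorem fourier_helmholtzKernel {α : ℝ} (hα : 0 < α) (ξ : V) :
    𝓕 (fun z : V => ((helmholtzKernel α z).toReal : ℂ)) ξ =
      (((1 + α ^ 2 * (2 * Real.pi * ‖ξ‖) ^ 2)⁻¹ : ℝ) : ℂ) := by
  have hint : Integrable (Function.uncurry fun (z : V) (t : ℝ) =>
      Complex.exp (((-2 * Real.pi * inner ℝ z ξ : ℝ) : ℂ) * Complex.I) *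
        ((Real.exp (-t) * heatKernel (α ^ 2 * t) z : ℝ) : ℂ))
      (volume.prod (volume.restrict (Set.Ioi 0))) := by
    have h := (integrable_exp_mul_heatKernel (V := V) hα).ofReal (𝕜 := ℂ)
    refine h.bdd_mul (c := 1) (f := fun p : V × ℝ =>
      Complex.exp (((-2 * Real.pi * inner ℝ p.1 ξ : ℝ) : ℂ) * Complex.I)) ?_ ?_
    · exact Continuous.aestronglyMeasurable (by fun_prop)
    · exact ae_of_all _ fun p => (Complex.norm_exp_ofReal_mul_I _).le
  have e1 : ∀ z : V, Complex.exp (((-2 * Real.pi * inner ℝ z ξ : ℝ) : ℂ) * Complex.I) •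
      ((helmholtzKernel α z).toReal : ℂ) = ∫ t in Set.Ioi (0 : ℝ),
        Complex.exp (((-2 * Real.pi * inner ℝ z ξ : ℝ) : ℂ) * Complex.I) *
          ((Real.exp (-t) * heatKernel (α ^ 2 * t) z : ℝ) : ℂ) := by
    intro z
    rw [toReal_helmholtzKernel, integral_const_mul, integral_complex_ofReal, smul_eq_mul]
  rw [Real.fourier_eq']
  simp_rw [e1]
  rw [integral_integral_swap hint]
  have e2 : ∀ t ∈ Set.Ioi (0 : ℝ), ∫ z : V,
      Complex.exp (((-2 * Real.pi * inner ℝ z ξ : ℝ) : ℂ) * Complex.I) *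
          ((Real.exp (-t) * heatKernel (α ^ 2 * t) z : ℝ) : ℂ) =
      ((Real.exp (-(1 + α ^ 2 * (2 * Real.pi * ‖ξ‖) ^ 2) * t) : ℝ) : ℂ) := by
    intro t ht
    have hF := fourier_heatKernel (mul_pos (pow_pos hα 2) ht) ξ
    rw [Real.fourier_eq'] at hF
    have : ∀ z : V, Complex.exp (((-2 * Real.pi * inner ℝ z ξ : ℝ) : ℂ) * Complex.I) *
          ((Real.exp (-t) * heatKernel (α ^ 2 * t) z : ℝ) : ℂ) = ((Real.exp (-t) : ℝ) : ℂ) *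
        (Complex.exp (((-2 * Real.pi * inner ℝ z ξ : ℝ) : ℂ) * Complex.I) •
          (heatKernel (α ^ 2 * t) z : ℂ)) := by
      intro z
      rw [smul_eq_mul]
      push_cast
      ring
    simp_rw [this]
    rw [integral_const_mul, hF, ← Complex.ofReal_mul, ← Real.exp_add]
    congr 2
    ring
  have hc : 0 < 1 + α ^ 2 * (2 * Real.pi * ‖ξ‖) ^ 2 := by positivity
  rw [setIntegral_congr_fun measurableSet_Ioi e2, integral_complex_ofReal,
    integral_exp_mul_Ioi (neg_lt_zero.2 hc) 0, mul_zero, Real.exp_zero, neg_div_neg_eq, one_div]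

theorem fourier_helmholtz_apply (α : ℝ) (φ : 𝓢(V, ℂ)) (ξ : V) :
    𝓕 (φ - ((α ^ 2 : ℝ) : ℂ) • Δ φ) ξ = ((1 + α ^ 2 * (2 * Real.pi * ‖ξ‖) ^ 2 : ℝ) : ℂ) * 𝓕 φ ξ := by
  have hg : (fun ξ : V => Complex.ofReal (‖ξ‖ ^ 2)).HasTemperateGrowth := by fun_prop
  have h : 𝓕 (Δ φ) ξ = ((-(2 * Real.pi) ^ 2 * ‖ξ‖ ^ 2 : ℝ) : ℂ) * 𝓕 φ ξ := by
    rw [SchwartzMap.laplacian_eq_fourierMultiplierCLM, ← Complex.coe_smul,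
      FourierTransform.fourier_smul, SchwartzMap.fourierMultiplierCLM_apply,
      FourierTransform.fourier_fourierInv_eq, _root_.smul_apply,
      SchwartzMap.smulLeftCLM_apply_apply (by fun_prop)]
    simp only [smul_eq_mul, Complex.real_smul]
    push_cast
    ring
  rw [sub_eq_add_neg, ← neg_smul, FourierTransform.fourier_add, FourierTransform.fourier_smul,
    _root_.add_apply, _root_.smul_apply, h, smul_eq_mul]
  push_cast
  ring

/-- Convolution with the fundamental solution inverts the Helmholtz operator on Schwartz
functions. -/
theorem integral_helmholtzKernel_mul_helmholtz {α : ℝ} (hα : 0 < α) (φ : 𝓢(V, ℂ)) (y : V) :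
    ∫ x, ((helmholtzKernel α (x - y)).toReal : ℂ) * (φ - ((α ^ 2 : ℝ) : ℂ) • Δ φ) x = φ y := by
  set ψ : 𝓢(V, ℂ) := φ - ((α ^ 2 : ℝ) : ℂ) • Δ φ with hψ
  have hk : Integrable (fun x : V => ((helmholtzKernel α (x - y)).toReal : ℂ)) :=
    ((integrable_toReal_helmholtzKernel hα).ofReal (𝕜 := ℂ)).comp_sub_right y
  have h1 : ∀ x, ψ x = 𝓕 ((𝓕⁻ ψ : 𝓢(V, ℂ)) : V → ℂ) x := fun x => by
    rw [← SchwartzMap.fourier_coe, FourierTransform.fourier_fourierInv_eq]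
  have h2 : φ y = 𝓕 ((𝓕⁻ φ : 𝓢(V, ℂ)) : V → ℂ) y := by
    rw [← SchwartzMap.fourier_coe, FourierTransform.fourier_fourierInv_eq]
  simp_rw [h1]
  -- Moving the Fourier transform onto the translated kernel produces a phase times the inverse
  -- symbol; the symbol coming from ψ cancels it, leaving Fourier inversion for φ at y.
  rw [← integral_fourier_mul_eq_integral_mul_fourier hk (𝓕⁻ ψ).integrable, h2, Real.fourier_eq']
  refine integral_congr_ae (ae_of_all _ fun ξ => ?_)
  have h3 : 𝓕 (fun x : V => ((helmholtzKernel α (x - y)).toReal : ℂ)) ξ =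
      Complex.exp (((-2 * Real.pi * inner ℝ ξ y : ℝ) : ℂ) * Complex.I) *
        (((1 + α ^ 2 * (2 * Real.pi * ‖ξ‖) ^ 2)⁻¹ : ℝ) : ℂ) := by
    rw [← fourier_helmholtzKernel hα ξ, Real.fourier_eq', Real.fourier_eq',
      ← integral_const_mul, ← integral_add_right_eq_self _ y]
    refine integral_congr_ae (ae_of_all _ fun x => ?_)
    simp only [add_sub_cancel_right, smul_eq_mul]
    rw [← mul_assoc, ← Complex.exp_add, inner_add_left, real_inner_comm y ξ]
    congr 2
    push_cast
    ring
  have h4 : (𝓕⁻ ψ : 𝓢(V, ℂ)) ξ =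
      ((1 + α ^ 2 * (2 * Real.pi * ‖ξ‖) ^ 2 : ℝ) : ℂ) * (𝓕⁻ φ : 𝓢(V, ℂ)) ξ := by
    have := fourier_helmholtz_apply α φ (-ξ)
    rw [norm_neg] at this
    rw [SchwartzMap.fourierInv_coe, SchwartzMap.fourierInv_coe, Real.fourierInv_eq_fourier_neg,
      Real.fourierInv_eq_fourier_neg, ← SchwartzMap.fourier_coe, ← SchwartzMap.fourier_coe, this]
  have hc : 1 + α ^ 2 * (2 * Real.pi * ‖ξ‖) ^ 2 ≠ 0 := by positivity
  simp only [h3, h4, smul_eq_mul]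
  rw [mul_assoc, ← mul_assoc (((_ : ℝ) : ℂ)), ← Complex.ofReal_mul, inv_mul_cancel₀ hc,
    Complex.ofReal_one, one_mul]

end Fourier

/-! ### Convolution with the Helmholtz kernel and its bounds. -/

section Convolution

variable {V : Type*} [NormedAddCommGroup V] [InnerProductSpace ℝ V] [MeasurableSpace V]
  [BorelSpace V] [FiniteDimensional ℝ V]

/-- The convolution of the fundamental solution of `I - α² Δ` with `g`. -/
noncomputable def helmholtzConv (α : ℝ) (g : V → ℂ) (x : V) : ℂ :=
  ∫ y, ((helmholtzKernel α (x - y)).toReal : ℂ) * g y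

/-- The convolution of the fundamental solution of `I - α² Δ` with a nonnegative function. -/
noncomputable def helmholtzLConv (α : ℝ) (f : V → ℝ≥0∞) (x : V) : ℝ≥0∞ :=
  ∫⁻ y, helmholtzKernel α (x - y) * f y

theorem measurable_helmholtzLConv (α : ℝ) {f : V → ℝ≥0∞} (hf : Measurable f) :
    Measurable (helmholtzLConv α f) :=
  Measurable.lintegral_prod_right' (f := fun p : V × V => helmholtzKernel α (p.1 - p.2) * f p.2)
    (by fun_prop)

theorem stronglyMeasurable_helmholtzConv (α : ℝ) {g : V → ℂ} (hg : Measurable g) :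
    StronglyMeasurable (helmholtzConv α g) :=
  StronglyMeasurable.integral_prod_right'
    (f := fun p : V × V => ((helmholtzKernel α (p.1 - p.2)).toReal : ℂ) * g p.2)
    (Measurable.stronglyMeasurable (by fun_prop))

theorem lintegral_helmholtzLConv_rpow_le {α p q : ℝ} (hpq : p.HolderConjugate q) (hq : 2 ≤ q)
    {f : V → ℝ≥0∞} (hf : Measurable f) :
    ∫⁻ x, helmholtzLConv α f x ^ q ≤
      (∫⁻ z : V, helmholtzKernel α z ^ (q / 2)) ^ 2 * (∫⁻ y, f y ^ p) ^ (q - 1) :=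
  lintegral_lintegral_mul_rpow_le (measurable_helmholtzKernel α) hf hpq hq

theorem lintegral_helmholtzLConv_rpow_rpow_le {α p q : ℝ} (hpq : p.HolderConjugate q) (hq : 2 ≤ q)
    {f : V → ℝ≥0∞} (hf : Measurable f) :
    (∫⁻ x, helmholtzLConv α f x ^ q) ^ (1 / q) ≤
      ((∫⁻ z : V, helmholtzKernel α z ^ (q / 2)) ^ (1 / q)) ^ 2 * (∫⁻ y, f y ^ p) ^ (1 / p) := by
  have h := ENNReal.rpow_le_rpow (lintegral_helmholtzLConv_rpow_le (α := α) hpq hq hf)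
    (show 0 ≤ 1 / q by positivity)
  rw [ENNReal.mul_rpow_of_nonneg _ _ (by positivity), ← ENNReal.rpow_mul, ← ENNReal.rpow_natCast,
    ← ENNReal.rpow_mul, mul_comm _ (1 / q), ENNReal.rpow_mul, ENNReal.rpow_natCast] at h
  have e : (q - 1) * (1 / q) = 1 / p := by
    have : q ≠ 0 := by positivity
    rw [one_div p, eq_sub_of_add_eq hpq.inv_add_inv_eq_one]
    field_simp
  rwa [e] at h

/-- Only an inequality, because the kernel is infinite at the origin in dimension at least 2, where
`toReal` returns 0. -/
theorem enorm_ofReal_toReal_mul_le (a : ℝ≥0∞) (c : ℂ) : ‖((a.toReal : ℝ) : ℂ) * c‖ₑ ≤ a * ‖c‖ₑ := by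
  rw [enorm_mul]
  gcongr
  rw [← ofReal_norm, Complex.norm_real, Real.norm_of_nonneg ENNReal.toReal_nonneg]
  exact ENNReal.ofReal_toReal_le

theorem enorm_helmholtzConv_le (α : ℝ) (g : V → ℂ) (x : V) :
    ‖helmholtzConv α g x‖ₑ ≤ helmholtzLConv α (fun y => ‖g y‖ₑ) x :=
  (enorm_integral_le_lintegral_enorm _).trans
    (lintegral_mono fun _ => enorm_ofReal_toReal_mul_le _ _)

theorem integrable_helmholtzKernel_mul {α : ℝ} {g : V → ℂ} (hg : Measurable g) {x : V}
    (h : helmholtzLConv α (fun y => ‖g y‖ₑ) x < ∞) :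
    Integrable (fun y => ((helmholtzKernel α (x - y)).toReal : ℂ) * g y) :=
  ⟨Measurable.aestronglyMeasurable (by fun_prop),
    (lintegral_mono fun _ => enorm_ofReal_toReal_mul_le _ _).trans_lt h⟩

/-- Finiteness of both absolute convolutions at x makes the two integrals genuine, so that they may
be subtracted under the integral sign. -/
theorem enorm_helmholtzConv_sub_le {α : ℝ} {g₁ g₂ : V → ℂ} (hg₁ : Measurable g₁)
    (hg₂ : Measurable g₂) {x : V} (h₁ : helmholtzLConv α (fun y => ‖g₁ y‖ₑ) x < ∞)
    (h₂ : helmholtzLConv α (fun y => ‖g₂ y‖ₑ) x < ∞) :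
    ‖helmholtzConv α g₁ x - helmholtzConv α g₂ x‖ₑ ≤
      helmholtzLConv α (fun y => ‖g₁ y - g₂ y‖ₑ) x := by
  unfold helmholtzConv
  rw [← integral_sub (integrable_helmholtzKernel_mul hg₁ h₁)
    (integrable_helmholtzKernel_mul hg₂ h₂)]
  simp_rw [← mul_sub]
  exact (enorm_integral_le_lintegral_enorm _).trans
    (lintegral_mono fun _ => enorm_ofReal_toReal_mul_le _ _)

/-- Admissible exponents for the `Lᵖ`-`L^q` bound of the Helmholtz resolvent, `p` and `q` being
conjugate. -/
theorem lintegral_helmholtzLConv_rpow_lt_top {α p q : ℝ} (hα : 0 < α) (hpq : p.HolderConjugate q)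
    (hq : 2 < q) (hqd : ((Module.finrank ℝ V : ℝ) - 2) * q < 2 * Module.finrank ℝ V)
    {f : V → ℝ≥0∞} (hf : Measurable f) (hfp : ∫⁻ y, f y ^ p < ∞) :
    ∫⁻ x, helmholtzLConv α f x ^ q < ∞ := by
  refine (lintegral_helmholtzLConv_rpow_le hpq hq.le hf).trans_lt ?_
  have := lintegral_helmholtzKernel_rpow_lt_top (V := V) (s := q / 2) hα (by linarith)
    (by linarith)
  exact ENNReal.mul_lt_top (ENNReal.pow_lt_top this)
    (ENNReal.rpow_lt_top_of_nonneg (by linarith) hfp.ne)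

end Convolution

/-! ### The convolution solves the Helmholtz equation. -/

section Solution

variable {N : ℕ}

theorem represents_toLp {p : ℝ≥0∞} [hp : Fact (1 ≤ p)] {g : EuclideanSpace ℝ (Fin N) → ℂ}
    (hg : MemLp g p) :
    Represents g ((hg.toLp g : Lp ℂ p (volume : Measure (EuclideanSpace ℝ (Fin N)))) :
      𝓢'(EuclideanSpace ℝ (Fin N), ℂ)) := by
  intro φ
  have := ENNReal.HolderConjugate.inv_one_sub_inv' hp.out
  refine ⟨(φ.memLp (1 - p⁻¹)⁻¹ volume).integrable_mul hg, ?_⟩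
  rw [Lp.toTemperedDistribution_apply]
  refine integral_congr_ae ?_
  filter_upwards [hg.coeFn_toLp] with x hx
  rw [hx, smul_eq_mul]

theorem memLp_ofReal_iff {X E : Type*} [MeasurableSpace X] {μ : Measure X} [NormedAddCommGroup E]
    {f : X → E} {p : ℝ} (hp : 0 < p) (hf : AEStronglyMeasurable f μ) :
    MemLp f (ENNReal.ofReal p) μ ↔ ∫⁻ x, ‖f x‖ₑ ^ p ∂μ < ∞ := by
  rw [MemLp, and_iff_right hf, eLpNorm_lt_top_iff_lintegral_rpow_enorm_lt_top
    (by simpa using hp) ENNReal.ofReal_ne_top, ENNReal.toReal_ofReal hp.le]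

theorem memLp_helmholtzConv {α p q : ℝ} (hα : 0 < α) (hpq : p.HolderConjugate q) (hq : 2 < q)
    (hqN : ((N : ℝ) - 2) * q < 2 * N) {g : EuclideanSpace ℝ (Fin N) → ℂ} (hg : Measurable g)
    (hgp : ∫⁻ y, ‖g y‖ₑ ^ p < ∞) :
    MemLp (helmholtzConv α g) (ENNReal.ofReal q) := by
  rw [memLp_ofReal_iff (by linarith) (stronglyMeasurable_helmholtzConv α hg).aestronglyMeasurable]
  refine (lintegral_mono fun x => ENNReal.rpow_le_rpow (enorm_helmholtzConv_le α g x)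
    (by linarith)).trans_lt ?_
  exact lintegral_helmholtzLConv_rpow_lt_top hα hpq hq (by simpa using hqN) hg.enorm hgp

/-- Tested against φ, the operator moves onto φ. Fubini then brings the kernel onto φ - α²Δφ, where
it gives back φ. -/
theorem isHelmholtzSolution_helmholtzConv {α p q : ℝ} (hα : 0 < α) (hpq : p.HolderConjugate q)
    (hq : 2 < q) (hqN : ((N : ℝ) - 2) * q < 2 * N) {g : EuclideanSpace ℝ (Fin N) → ℂ}
    (hg : Measurable g) (hgp : ∫⁻ y, ‖g y‖ₑ ^ p < ∞) :
    IsHelmholtzSolution α g (helmholtzConv α g) := by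
  have hp1 : Fact (1 ≤ ENNReal.ofReal p) := ⟨by simpa using hpq.lt.le⟩
  have hq1 : Fact (1 ≤ ENNReal.ofReal q) := ⟨by simpa using (by linarith : 1 ≤ q)⟩
  have hgLp : MemLp g (ENNReal.ofReal p) :=
    (memLp_ofReal_iff hpq.pos hg.aestronglyMeasurable).2 hgp
  have huLp := memLp_helmholtzConv hα hpq hq hqN hg hgp
  refine ⟨_, _, represents_toLp hgLp, represents_toLp huLp, ?_⟩
  ext φ
  set ψ : 𝓢(EuclideanSpace ℝ (Fin N), ℂ) := φ - ((α ^ 2 : ℝ) : ℂ) • Δ φ with hψ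
  set U : 𝓢'(EuclideanSpace ℝ (Fin N), ℂ) :=
    ((huLp.toLp _ : Lp ℂ (ENNReal.ofReal q) (volume : Measure (EuclideanSpace ℝ (Fin N)))) :
      𝓢'(EuclideanSpace ℝ (Fin N), ℂ)) with hU
  have h1 : (U - ((α ^ 2 : ℝ) : ℂ) • Δ U) φ = U ψ := by
    rw [hψ, map_sub, map_smul, ← laplacian_apply_apply]
    rfl
  rw [h1, ((represents_toLp huLp) ψ).2, ((represents_toLp hgLp) φ).2]
  -- Fubini is justified by Hölder: ψ is in Lᵖ, and the convolution of the kernel with |g| is in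
  -- L^q.
  have hint : Integrable (Function.uncurry fun x y : EuclideanSpace ℝ (Fin N) =>
      ψ x * (((helmholtzKernel α (x - y)).toReal : ℂ) * g y)) (volume.prod volume) := by
    have hm : Measurable (Function.uncurry fun x y : EuclideanSpace ℝ (Fin N) =>
      ψ x * (((helmholtzKernel α (x - y)).toReal : ℂ) * g y)) := by
      have := ψ.continuous.measurable
      unfold Function.uncurry
      fun_prop
    refine ⟨hm.aestronglyMeasurable, ?_⟩
    rw [hasFiniteIntegral_iff_enorm, lintegral_prod _ hm.enorm.aemeasurable]
    have hLm := measurable_helmholtzLConv α hg.enorm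
    have hle : ∀ x : EuclideanSpace ℝ (Fin N), ∫⁻ y : EuclideanSpace ℝ (Fin N),
        ‖ψ x * (((helmholtzKernel α (x - y)).toReal : ℂ) * g y)‖ₑ ≤
          ‖ψ x‖ₑ * helmholtzLConv α (fun y => ‖g y‖ₑ) x := by
      intro x
      rw [helmholtzLConv, ← lintegral_const_mul' _ _ enorm_ne_top]
      refine lintegral_mono fun y => ?_
      rw [enorm_mul]
      gcongr
      exact enorm_ofReal_toReal_mul_le _ _
    refine (lintegral_mono hle).trans_lt ?_
    refine (ENNReal.lintegral_mul_le_Lp_mul_Lq volume hpq ψ.continuous.measurable.enorm.aemeasurable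
      hLm.aemeasurable).trans_lt ?_
    refine ENNReal.mul_lt_top (ENNReal.rpow_lt_top_of_nonneg (by have := hpq.pos; positivity)
      (LT.lt.ne ?_)) (ENNReal.rpow_lt_top_of_nonneg (by positivity) (LT.lt.ne ?_))
    · exact (memLp_ofReal_iff hpq.pos ψ.continuous.aestronglyMeasurable).1
        (ψ.memLp (ENNReal.ofReal p) volume)
    · exact lintegral_helmholtzLConv_rpow_lt_top hα hpq hq (by simpa using hqN) hg.enorm hgp
  unfold helmholtzConv
  simp_rw [← integral_const_mul]
  rw [integral_integral_swap hint]
  refine integral_congr_ae (ae_of_all _ fun y => ?_)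
  simp only
  rw [← integral_helmholtzKernel_mul_helmholtz hα φ y, ← integral_mul_const]
  refine integral_congr_ae (ae_of_all _ fun x => ?_)
  simp only [hψ]
  ring

end Solution

/-! ### The H⁻¹ quadratic form bounded by the kernel. -/

section Bilinear

variable {V : Type*} [NormedAddCommGroup V] [InnerProductSpace ℝ V] [FiniteDimensional ℝ V]
  [MeasurableSpace V] [BorelSpace V]

theorem norm_fourier_le_integral_norm (f : V → ℂ) (ξ : V) : ‖𝓕 f ξ‖ ≤ ∫ x, ‖f x‖ :=
  VectorFourier.norm_fourierIntegral_le_integral_norm _ _ _ _ _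

theorem continuous_fourier {f : V → ℂ} (hf : Integrable f) : Continuous (𝓕 f) :=
  VectorFourier.fourierIntegral_continuous Real.continuous_fourierChar continuous_inner hf

theorem conj_fourier (f : V → ℂ) (ξ : V) :
    (starRingEnd ℂ) (𝓕 f ξ) = 𝓕 (fun y => (starRingEnd ℂ) (f (-y))) ξ := by
  rw [Real.fourier_eq', Real.fourier_eq', ← integral_conj,
    ← integral_neg_eq_self (fun y => Complex.exp _ • (starRingEnd ℂ) (f (-y)))]
  refine integral_congr_ae (ae_of_all _ fun y => ?_)
  simp only [smul_eq_mul, map_mul, ← Complex.exp_conj, Complex.conj_ofReal, Complex.conj_I,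
    neg_neg, inner_neg_left]
  push_cast
  congr 2
  ring

/-- Convolution of an integrable function with a heat kernel, on the Fourier side. -/
theorem fourier_gaussian_mul_conj_fourier {a : ℝ} (ha : 0 < a) {f : V → ℂ} (hf : Integrable f)
    (x : V) :
    𝓕 (fun ξ => ((Real.exp (-(4 * Real.pi ^ 2 * a) * ‖ξ‖ ^ 2) : ℝ) : ℂ) *
      (starRingEnd ℂ) (𝓕 f ξ)) x = ∫ y, (heatKernel a (x - y) : ℂ) * (starRingEnd ℂ) (f y) := by
  have hγ : Integrable (fun ξ : V => ((Real.exp (-(4 * Real.pi ^ 2 * a) * ‖ξ‖ ^ 2) : ℝ) : ℂ)) :=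
    (integrable_exp_neg_mul_sq_norm (by positivity)).ofReal
  have hF : Integrable (fun ξ : V =>
      Complex.exp (((-2 * Real.pi * inner ℝ ξ x : ℝ) : ℂ) * Complex.I) *
        ((Real.exp (-(4 * Real.pi ^ 2 * a) * ‖ξ‖ ^ 2) : ℝ) : ℂ)) := by
    refine hγ.bdd_mul (c := 1) (Continuous.aestronglyMeasurable (by fun_prop)) ?_
    exact ae_of_all _ fun p => (Complex.norm_exp_ofReal_mul_I _).le
  have hg : Integrable (fun y => (starRingEnd ℂ) (f (-y))) := by
    have := hf.comp_neg
    exact (LinearIsometryEquiv.integrable_comp_iff Complex.conjLIE).2 this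
  have h := integral_fourier_mul_eq_integral_mul_fourier hF hg
  have e1 : ∀ y, 𝓕 (fun ξ : V =>
      Complex.exp (((-2 * Real.pi * inner ℝ ξ x : ℝ) : ℂ) * Complex.I) *
        ((Real.exp (-(4 * Real.pi ^ 2 * a) * ‖ξ‖ ^ 2) : ℝ) : ℂ)) y = (heatKernel a (x + y) : ℂ) := by
    intro y
    rw [← fourier_gaussian_eq_heatKernel ha, Real.fourier_eq', Real.fourier_eq']
    refine integral_congr_ae (ae_of_all _ fun ξ => ?_)
    simp only [smul_eq_mul]
    rw [← mul_assoc, ← Complex.exp_add, inner_add_right]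
    congr 2
    push_cast
    ring
  simp_rw [e1] at h
  rw [← integral_neg_eq_self] at h
  simp only [neg_neg, ← sub_eq_add_neg] at h
  rw [h, Real.fourier_eq']
  refine integral_congr_ae (ae_of_all _ fun ξ => ?_)
  simp only [smul_eq_mul, conj_fourier]
  ring

/-- Moving one Fourier transform across the pairing of 𝓕 f with γ times the conjugate of 𝓕 f turns
the Gaussian γ into a heat kernel acting on the conjugate of f. Absolute values may then be taken
inside, the heat kernel being nonnegative. -/
theorem lintegral_gaussian_mul_enorm_fourier_sq_le {a : ℝ} (ha : 0 < a) {f : V → ℂ}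
    (hf : Integrable f) :
    ∫⁻ ξ, ENNReal.ofReal (Real.exp (-(4 * Real.pi ^ 2 * a) * ‖ξ‖ ^ 2)) * ‖𝓕 f ξ‖ₑ ^ 2 ≤
      ∫⁻ x, ∫⁻ y, ENNReal.ofReal (heatKernel a (x - y)) * (‖f x‖ₑ * ‖f y‖ₑ) := by
  set γ : V → ℝ := fun ξ => Real.exp (-(4 * Real.pi ^ 2 * a) * ‖ξ‖ ^ 2) with hγ
  have hγi : Integrable γ := integrable_exp_neg_mul_sq_norm (by positivity)
  have hc := continuous_fourier hf
  have hW : Integrable (fun ξ => (γ ξ : ℂ) * (starRingEnd ℂ) (𝓕 f ξ)) := by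
    refine (hγi.ofReal (𝕜 := ℂ)).mul_bdd (c := ∫ x, ‖f x‖)
      (Complex.continuous_conj.comp hc).aestronglyMeasurable (ae_of_all _ fun ξ => ?_)
    rw [RCLike.norm_conj]
    exact norm_fourier_le_integral_norm f ξ
  have h1 := integral_fourier_mul_eq_integral_mul_fourier hf hW
  simp_rw [hγ, fourier_gaussian_mul_conj_fourier ha hf] at h1
  have e : ∀ ξ, 𝓕 f ξ * ((γ ξ : ℂ) * (starRingEnd ℂ) (𝓕 f ξ)) =
      ((γ ξ * ‖𝓕 f ξ‖ ^ 2 : ℝ) : ℂ) := by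
    intro ξ
    rw [mul_left_comm, Complex.mul_conj']
    push_cast
    rfl
  have hint : Integrable (fun ξ => γ ξ * ‖𝓕 f ξ‖ ^ 2) := by
    refine hγi.mul_bdd (c := (∫ x, ‖f x‖) ^ 2) (hc.norm.pow 2).aestronglyMeasurable
      (ae_of_all _ fun ξ => ?_)
    rw [norm_pow, norm_norm]
    gcongr
    exact norm_fourier_le_integral_norm f ξ
  have h2 : ∫⁻ ξ, ENNReal.ofReal (γ ξ) * ‖𝓕 f ξ‖ₑ ^ 2 =
      ‖∫ ξ, 𝓕 f ξ * ((γ ξ : ℂ) * (starRingEnd ℂ) (𝓕 f ξ))‖ₑ := by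
    simp_rw [e]
    rw [integral_complex_ofReal, ← ofReal_norm, Complex.norm_real, Real.norm_of_nonneg
      (integral_nonneg fun ξ => by positivity), ofReal_integral_eq_lintegral_ofReal hint
      (ae_of_all _ fun ξ => by positivity)]
    refine lintegral_congr fun ξ => ?_
    rw [ENNReal.ofReal_mul (Real.exp_pos _).le, ENNReal.ofReal_pow (norm_nonneg _), ofReal_norm]
  rw [h2]
  simp only [hγ]
  rw [h1]
  refine (enorm_integral_le_lintegral_enorm _).trans (lintegral_mono fun x => ?_)
  rw [enorm_mul]
  have h3 : ‖∫ y, (heatKernel a (x - y) : ℂ) * (starRingEnd ℂ) (f y)‖ₑ ≤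
      ∫⁻ y, ENNReal.ofReal (heatKernel a (x - y)) * ‖f y‖ₑ := by
    refine (enorm_integral_le_lintegral_enorm _).trans_eq (lintegral_congr fun y => ?_)
    rw [enorm_mul, ← ofReal_norm, Complex.norm_real, Real.norm_of_nonneg
      (heatKernel_nonneg ha.le _), RCLike.enorm_conj]
  calc ‖f x‖ₑ * ‖∫ y, (heatKernel a (x - y) : ℂ) * (starRingEnd ℂ) (f y)‖ₑ
      ≤ ‖f x‖ₑ * ∫⁻ y, ENNReal.ofReal (heatKernel a (x - y)) * ‖f y‖ₑ := by gcongr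
    _ = ∫⁻ y, ENNReal.ofReal (heatKernel a (x - y)) * (‖f x‖ₑ * ‖f y‖ₑ) := by
      rw [← lintegral_const_mul' _ _ enorm_ne_top]
      refine lintegral_congr fun y => ?_
      ring

/-- The quadratic form of `(I - Δ)⁻¹` is controlled by the one of its kernel. -/
theorem lintegral_inv_symbol_mul_enorm_fourier_sq_le {f : V → ℂ} (hf : Integrable f)
    (hfm : Measurable f) :
    ∫⁻ ξ, ENNReal.ofReal (1 / (1 + (2 * Real.pi * ‖ξ‖) ^ 2)) * ‖𝓕 f ξ‖ₑ ^ 2 ≤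
      ∫⁻ x, ‖f x‖ₑ * helmholtzLConv 1 (fun y => ‖f y‖ₑ) x := by
  have hFm : Measurable (𝓕 f) := (continuous_fourier hf).measurable
  -- Subordination: the inverse symbol is the integral of e^{-t} e^{-t|2πξ|²} over t > 0. The
  -- estimate for one Gaussian is applied at each t, and integrating the heat kernels back in t
  -- rebuilds the Helmholtz kernel with α = 1.
  have h1 : ∀ ξ : V, ENNReal.ofReal (1 / (1 + (2 * Real.pi * ‖ξ‖) ^ 2)) * ‖𝓕 f ξ‖ₑ ^ 2 =
      ∫⁻ t in Set.Ioi (0 : ℝ), ENNReal.ofReal (Real.exp (-t)) *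
        (ENNReal.ofReal (Real.exp (-(4 * Real.pi ^ 2 * t) * ‖ξ‖ ^ 2)) * ‖𝓕 f ξ‖ₑ ^ 2) := by
    intro ξ
    rw [← lintegral_exp_neg_mul_Ioi (by positivity), ← lintegral_mul_const' _ _ (by finiteness)]
    refine lintegral_congr fun t => ?_
    rw [← mul_assoc, ← ENNReal.ofReal_mul (Real.exp_pos _).le, ← Real.exp_add]
    congr 3
    ring
  have hk : Measurable (fun p : (ℝ × V) × V => heatKernel p.1.1 (p.1.2 - p.2)) :=
    measurable_heatKernel.comp (f := fun p : (ℝ × V) × V => (p.1.1, p.1.2 - p.2)) (by fun_prop)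
  have hkx (x : V) : Measurable (fun p : ℝ × V => heatKernel p.1 (x - p.2)) :=
    measurable_heatKernel.comp (f := fun p : ℝ × V => (p.1, x - p.2)) (by fun_prop)
  calc ∫⁻ ξ, ENNReal.ofReal (1 / (1 + (2 * Real.pi * ‖ξ‖) ^ 2)) * ‖𝓕 f ξ‖ₑ ^ 2
      = ∫⁻ t in Set.Ioi (0 : ℝ), ∫⁻ ξ, ENNReal.ofReal (Real.exp (-t)) *
        (ENNReal.ofReal (Real.exp (-(4 * Real.pi ^ 2 * t) * ‖ξ‖ ^ 2)) * ‖𝓕 f ξ‖ₑ ^ 2) := by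
        simp_rw [h1]
        rw [lintegral_lintegral_swap (Measurable.aemeasurable (by fun_prop))]
    _ ≤ ∫⁻ t in Set.Ioi (0 : ℝ), ∫⁻ x, ∫⁻ y, ENNReal.ofReal (Real.exp (-t)) *
          (ENNReal.ofReal (heatKernel t (x - y)) * (‖f x‖ₑ * ‖f y‖ₑ)) := by
        refine setLIntegral_mono' measurableSet_Ioi fun t ht => ?_
        rw [lintegral_const_mul' _ _ ENNReal.ofReal_ne_top]
        simp_rw [lintegral_const_mul' _ _ (ENNReal.ofReal_ne_top (r := Real.exp (-t)))]
        exact mul_le_mul_right (lintegral_gaussian_mul_enorm_fourier_sq_le ht hf) _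
    _ = ∫⁻ x, ∫⁻ y, ∫⁻ t in Set.Ioi (0 : ℝ), ENNReal.ofReal (Real.exp (-t)) *
          (ENNReal.ofReal (heatKernel t (x - y)) * (‖f x‖ₑ * ‖f y‖ₑ)) := by
        rw [lintegral_lintegral_swap]
        · refine lintegral_congr fun x => ?_
          rw [lintegral_lintegral_swap (Measurable.aemeasurable ?_)]
          have := hkx x
          unfold Function.uncurry
          fun_prop
        · refine Measurable.aemeasurable ?_
          exact Measurable.lintegral_prod_right' (f := fun p : (ℝ × V) × V =>
            ENNReal.ofReal (Real.exp (-p.1.1)) * (ENNReal.ofReal (heatKernel p.1.1 (p.1.2 - p.2)) *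
              (‖f p.1.2‖ₑ * ‖f p.2‖ₑ))) (by fun_prop)
    _ = ∫⁻ x, ‖f x‖ₑ * helmholtzLConv 1 (fun y => ‖f y‖ₑ) x := by
        refine lintegral_congr fun x => ?_
        rw [helmholtzLConv, ← lintegral_const_mul' _ _ enorm_ne_top]
        refine lintegral_congr fun y => ?_
        rw [helmholtzKernel, mul_left_comm, ← lintegral_mul_const' _ _ (by finiteness)]
        refine lintegral_congr fun t => ?_
        rw [one_pow, one_mul, ENNReal.ofReal_mul (Real.exp_pos _).le, mul_assoc]

/-- Hölder for the pair p, q, then Young. The bound is written as a square since its square root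
bounds an H⁻¹ norm. -/
theorem lintegral_mul_helmholtzLConv_le {α p q : ℝ} (hpq : p.HolderConjugate q) (hq : 2 ≤ q)
    {f : V → ℝ≥0∞} (hf : Measurable f) :
    ∫⁻ x, f x * helmholtzLConv α f x ≤
      ((∫⁻ z : V, helmholtzKernel α z ^ (q / 2)) ^ (1 / q) * (∫⁻ y, f y ^ p) ^ (1 / p)) ^ 2 := by
  refine (ENNReal.lintegral_mul_le_Lp_mul_Lq volume hpq hf.aemeasurable
    (measurable_helmholtzLConv α hf).aemeasurable).trans ?_
  refine (mul_le_mul_right (lintegral_helmholtzLConv_rpow_rpow_le hpq hq hf) _).trans_eq ?_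
  ring

end Bilinear

/-! ### The subcritical Sobolev embedding by duality. -/

section Sobolev

variable {N : ℕ}

/-- The Fourier transform of `L¹ ∩ L²` functions is given by the integral. -/
theorem fourier_toLp_ae_eq {f : EuclideanSpace ℝ (Fin N) → ℂ} (hf1 : Integrable f)
    (hf2 : MemLp f 2) :
    (𝓕 (hf2.toLp f) : Lp ℂ 2 (volume : Measure (EuclideanSpace ℝ (Fin N)))) =ᵐ[volume] 𝓕 f := by
  have h1 := represents_coe (𝓕 (hf2.toLp f))
  rw [← Lp.fourier_toTemperedDistribution_eq] at h1
  -- Both functions represent the same tempered distribution, so they agree a.e.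
  refine h1.ae_eq fun φ => ⟨?_, ?_⟩
  · exact φ.integrable.mul_bdd (c := ∫ x, ‖f x‖) (continuous_fourier hf1).aestronglyMeasurable
      (ae_of_all _ fun ξ => norm_fourier_le_integral_norm f ξ)
  · rw [TemperedDistribution.fourier_apply, (represents_toLp hf2 (𝓕 φ)).2, SchwartzMap.fourier_coe,
      integral_fourier_mul_eq_integral_mul_fourier φ.integrable hf1]

/-- The duality between `H¹` and its dual, for the pairing of `L²`. -/
theorem enorm_inner_toLp_le {f : EuclideanSpace ℝ (Fin N) → ℂ} (hf1 : Integrable f)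
    (hf2 : MemLp f 2) (v : Lp ℂ 2 (volume : Measure (EuclideanSpace ℝ (Fin N)))) :
    ‖inner ℂ (hf2.toLp f) v‖ₑ ≤
      (∫⁻ ξ, ENNReal.ofReal (1 / (1 + (2 * Real.pi * ‖ξ‖) ^ 2)) * ‖𝓕 f ξ‖ₑ ^ 2) ^ (1 / 2 : ℝ) *
        h1Norm v := by
  -- Plancherel, followed by Cauchy–Schwarz with the weight 1 + |2πξ|² on v and its reciprocal on f.
  rw [← Lp.inner_fourier_eq, L2.inner_def]
  refine (enorm_integral_le_lintegral_enorm _).trans ?_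
  have hF := continuous_fourier hf1
  have h := ENNReal.lintegral_mul_norm_pow_le (μ := volume)
    (f := fun ξ => ENNReal.ofReal (1 / (1 + (2 * Real.pi * ‖ξ‖) ^ 2)) * ‖𝓕 f ξ‖ₑ ^ 2)
    (g := fun ξ => ENNReal.ofReal (1 + (2 * Real.pi * ‖ξ‖) ^ 2) *
      ‖(𝓕 v : Lp ℂ 2 (volume : Measure (EuclideanSpace ℝ (Fin N)))) ξ‖ₑ ^ 2)
    (p := 1 / 2) (q := 1 / 2) ?_ ?_ (by norm_num) (by norm_num) (by norm_num)
  · refine le_trans (le_of_eq (lintegral_congr_ae ?_)) h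
    filter_upwards [fourier_toLp_ae_eq hf1 hf2] with ξ hξ
    have hpos : 0 < 1 + (2 * Real.pi * ‖ξ‖) ^ 2 := by positivity
    rw [← ENNReal.mul_rpow_of_nonneg _ _ (by norm_num), mul_mul_mul_comm,
      ← ENNReal.ofReal_mul (by positivity), one_div_mul_cancel hpos.ne', ENNReal.ofReal_one,
      one_mul, ← mul_pow, ← ENNReal.rpow_natCast, ← ENNReal.rpow_mul, hξ, RCLike.inner_apply,
      enorm_mul, RCLike.enorm_conj, mul_comm]
    norm_num
  · have := hF.measurable
    fun_prop
  · have := (Lp.aestronglyMeasurable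
      (𝓕 v : Lp ℂ 2 (volume : Measure (EuclideanSpace ℝ (Fin N))))).enorm
    fun_prop

/-- The truncation to bounded |v| and bounded |x| makes the integral finite beforehand, so that a
power of it can be cancelled; the resulting bound does not depend on n. -/
theorem setLIntegral_enorm_rpow_le {r : ℝ} (hr : 2 < r)
    (v : Lp ℂ 2 (volume : Measure (EuclideanSpace ℝ (Fin N)))) (n : ℕ) :
    ∫⁻ x in {x | ‖v x‖ ≤ n ∧ ‖x‖ ≤ n}, ‖v x‖ₑ ^ r ≤
      ((∫⁻ z : EuclideanSpace ℝ (Fin N), helmholtzKernel 1 z ^ (r / 2)) ^ (1 / r) *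
        h1Norm v) ^ r := by
  have hr0 : 0 < r := by linarith
  set p : ℝ := Real.conjExponent r with hp
  have hpq : p.HolderConjugate r := (Real.HolderConjugate.conjExponent (by linarith)).symm
  have hvm : Measurable v := (Lp.stronglyMeasurable v).measurable
  set S : Set (EuclideanSpace ℝ (Fin N)) := {x | ‖v x‖ ≤ n ∧ ‖x‖ ≤ n} with hS
  have hSm : MeasurableSet S :=
    (measurableSet_le hvm.norm measurable_const).inter (measurableSet_le measurable_norm
      measurable_const)
  have hSf : volume S < ∞ :=
    (measure_mono fun x hx => by simpa using hx.2).trans_lt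
      (measure_closedBall_lt_top (x := (0 : EuclideanSpace ℝ (Fin N))) (r := n))
  -- The extremal element of duality: on S, the pairing of f with v has density |v|^r, and |f|^p =
  -- |v|^r too.
  set f : EuclideanSpace ℝ (Fin N) → ℂ :=
    S.indicator fun x => ((‖v x‖ ^ (r - 2) : ℝ) : ℂ) * v x with hf
  have hfm : Measurable f := Measurable.indicator (by fun_prop) hSm
  have hfb : ∀ x, ‖f x‖ ≤ (n : ℝ) ^ (r - 2) * n := by
    intro x
    by_cases hx : x ∈ S
    · rw [hf, Set.indicator_of_mem hx, norm_mul, Complex.norm_real, Real.norm_of_nonneg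
        (by positivity)]
      exact mul_le_mul (Real.rpow_le_rpow (norm_nonneg _) hx.1 (by linarith)) hx.1
        (norm_nonneg _) (by positivity)
    · rw [hf, Set.indicator_of_notMem hx, norm_zero]
      positivity
  have hfLp (s : ℝ≥0∞) : MemLp f s := by
    have : f = S.indicator f := by
      rw [hf, Set.indicator_indicator, Set.inter_self]
    rw [this, memLp_indicator_iff_restrict hSm]
    have : IsFiniteMeasure (volume.restrict S) := ⟨by simpa using hSf⟩
    exact MemLp.of_bound hfm.aestronglyMeasurable _ (ae_of_all _ hfb)
  set I : ℝ≥0∞ := ∫⁻ x in S, ‖v x‖ₑ ^ r with hI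
  have hItop : I ≠ ∞ := by
    refine (setLIntegral_lt_top_of_le_nnreal hSf.ne ⟨(n : ℝ≥0) ^ r, fun x hx => ?_⟩).ne
    rw [ENNReal.coe_rpow_of_nonneg _ hr0.le]
    gcongr
    have : ‖v x‖₊ ≤ (n : ℝ≥0) := by exact_mod_cast hx.1
    exact_mod_cast this
  have hinner : ‖inner ℂ ((hfLp 2).toLp f) v‖ₑ = I := by
    rw [L2.inner_def]
    have e : (fun x => inner ℂ ((hfLp 2).toLp f x) (v x)) =ᵐ[volume]
        S.indicator fun x => ((‖v x‖ ^ r : ℝ) : ℂ) := by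
      filter_upwards [(hfLp 2).coeFn_toLp] with x hx
      rw [hx]
      by_cases hxS : x ∈ S
      · rw [hf, Set.indicator_of_mem hxS, Set.indicator_of_mem hxS, RCLike.inner_apply, map_mul,
          Complex.conj_ofReal, mul_left_comm, Complex.mul_conj', ← Complex.ofReal_pow,
          ← Complex.ofReal_mul, ← Real.rpow_natCast, ← Real.rpow_add' (norm_nonneg _)
          (by push_cast; linarith)]
        congr 2
        push_cast
        ring
      · rw [hf, Set.indicator_of_notMem hxS, Set.indicator_of_notMem hxS, inner_zero_left]
    have hint : IntegrableOn (fun x => ‖v x‖ ^ r) S := by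
      refine ⟨(hvm.norm.pow_const r).aestronglyMeasurable, ?_⟩
      rw [hasFiniteIntegral_iff_enorm]
      refine lt_of_eq_of_lt (lintegral_congr fun x => ?_) hItop.lt_top
      rw [Real.enorm_rpow_of_nonneg (norm_nonneg _) hr0.le, enorm_norm]
    rw [integral_congr_ae e, integral_indicator hSm, integral_complex_ofReal, ← ofReal_norm,
      Complex.norm_real, Real.norm_of_nonneg (integral_nonneg fun x => by positivity),
      ofReal_integral_eq_lintegral_ofReal hint (ae_of_all _ fun x => by positivity)]
    refine lintegral_congr fun x => ?_
    rw [← ENNReal.ofReal_rpow_of_nonneg (norm_nonneg _) hr0.le, ofReal_norm]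
  have hfp : ∫⁻ x, ‖f x‖ₑ ^ p = I := by
    rw [hI, ← lintegral_indicator hSm]
    refine lintegral_congr fun x => ?_
    by_cases hxS : x ∈ S
    · rw [hf, Set.indicator_of_mem hxS, Set.indicator_of_mem hxS, enorm_mul, ← ofReal_norm,
        Complex.norm_real, Real.norm_of_nonneg (by positivity),
        ← ENNReal.ofReal_rpow_of_nonneg (norm_nonneg _) (by linarith), ofReal_norm]
      nth_rewrite 2 [← ENNReal.rpow_one ‖v x‖ₑ]
      rw [← ENNReal.rpow_add_of_nonneg _ _ (by linarith) one_pos.le, ← ENNReal.rpow_mul]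
      congr 1
      have := hpq.symm.sub_one_mul_conj
      linarith
    · rw [hf, Set.indicator_of_notMem hxS, Set.indicator_of_notMem hxS, enorm_zero,
        ENNReal.zero_rpow_of_pos hpq.pos]
  have h := enorm_inner_toLp_le (memLp_one_iff_integrable.1 (hfLp 1)) (hfLp 2) v
  rw [hinner] at h
  have h2 := (lintegral_inv_symbol_mul_enorm_fourier_sq_le
    (memLp_one_iff_integrable.1 (hfLp 1)) hfm).trans
      (lintegral_mul_helmholtzLConv_le hpq hr.le hfm.enorm)
  rw [hfp] at h2
  have h3 := ENNReal.rpow_le_rpow h2 (show (0 : ℝ) ≤ 1 / 2 by norm_num)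
  rw [← ENNReal.rpow_natCast, ← ENNReal.rpow_mul] at h3
  rw [show ((2 : ℕ) : ℝ) * (1 / 2) = 1 by norm_num, ENNReal.rpow_one] at h3
  set A : ℝ≥0∞ := (∫⁻ z : EuclideanSpace ℝ (Fin N), helmholtzKernel 1 z ^ (r / 2)) ^ (1 / r)
    with hA
  -- Since 1/p + 1/r = 1 and I is finite, cancelling I^{1/p} leaves I^{1/r} on the left, unless I =
  -- 0.
  have h4 : I ≤ I ^ (1 / p) * (A * h1Norm v) := by
    refine h.trans ((mul_le_mul_left h3 _).trans_eq ?_)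
    ring
  by_cases hI0 : I = 0
  · rw [hI0]; exact zero_le
  have h5 : I = I ^ (1 / p) * I ^ (1 / r) := by
    rw [← ENNReal.rpow_add _ _ hI0 hItop, one_div, one_div, hpq.inv_add_inv_eq_one,
      ENNReal.rpow_one]
  have h6 : I ^ (1 / r) ≤ A * h1Norm v := by
    nth_rewrite 1 [h5] at h4
    refine (ENNReal.mul_le_mul_iff_right ?_ ?_).1 h4
    · exact fun h0 => hI0 (ENNReal.rpow_eq_zero_iff_of_pos (by have := hpq.pos; positivity) |>.1 h0)
    · exact ENNReal.rpow_ne_top_of_nonneg (by have := hpq.pos; positivity) hItop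
  have h7 := ENNReal.rpow_le_rpow h6 hr0.le
  rwa [← ENNReal.rpow_mul, one_div_mul_cancel hr0.ne', ENNReal.rpow_one] at h7

/-- The subcritical Sobolev embedding of `H¹`. -/
theorem exists_eLpNorm_le_h1Norm {r : ℝ} (hr : 2 < r) (hrN : ((N : ℝ) - 2) * r < 2 * N) :
    ∃ C : ℝ≥0, ∀ v : Lp ℂ 2 (volume : Measure (EuclideanSpace ℝ (Fin N))),
      eLpNorm v (ENNReal.ofReal r) volume ≤ C * h1Norm v := by
  have hr0 : 0 < r := by linarith
  have hA : (∫⁻ z : EuclideanSpace ℝ (Fin N), helmholtzKernel 1 z ^ (r / 2)) ^ (1 / r) ≠ ∞ := by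
    refine ENNReal.rpow_ne_top_of_nonneg (by positivity) (LT.lt.ne ?_)
    refine lintegral_helmholtzKernel_rpow_lt_top one_pos (by linarith) ?_
    rw [finrank_euclideanSpace_fin]
    linarith
  refine ⟨ENNReal.toNNReal
    ((∫⁻ z : EuclideanSpace ℝ (Fin N), helmholtzKernel 1 z ^ (r / 2)) ^ (1 / r)), fun v => ?_⟩
  rw [ENNReal.coe_toNNReal hA, eLpNorm_eq_lintegral_rpow_enorm_toReal (by simpa using hr0)
    ENNReal.ofReal_ne_top, ENNReal.toReal_ofReal hr0.le]
  -- The truncation sets increase to the whole space, so the uniform bound passes to the limit.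
  have hU : (⋃ n : ℕ, {x | ‖v x‖ ≤ n ∧ ‖x‖ ≤ n}) = Set.univ := by
    refine Set.eq_univ_of_forall fun x => Set.mem_iUnion.2 ?_
    obtain ⟨n, hn⟩ := exists_nat_ge (max ‖v x‖ ‖x‖)
    exact ⟨n, (le_max_left _ _).trans hn, (le_max_right _ _).trans hn⟩
  have hmono : Monotone fun n : ℕ => {x | ‖v x‖ ≤ n ∧ ‖x‖ ≤ n} := by
    intro m n hmn x hx
    have : (m : ℝ) ≤ n := by exact_mod_cast hmn
    exact ⟨hx.1.trans this, hx.2.trans this⟩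
  have h : ∫⁻ x, ‖v x‖ₑ ^ r ≤
      ((∫⁻ z : EuclideanSpace ℝ (Fin N), helmholtzKernel 1 z ^ (r / 2)) ^ (1 / r) *
        h1Norm v) ^ r := by
    rw [← setLIntegral_univ, ← hU, setLIntegral_iUnion_of_directed _ hmono.directed_le]
    exact iSup_le fun n => setLIntegral_enorm_rpow_le hr v n
  have h7 := ENNReal.rpow_le_rpow h (show 0 ≤ 1 / r by positivity)
  rwa [← ENNReal.rpow_mul (_ * h1Norm v), mul_one_div_cancel hr0.ne', ENNReal.rpow_one] at h7

end Sobolev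

/-! ### Elementary inequalities for powers. -/

section Pointwise

/-- Bernoulli's inequality for (y/x)^σ, multiplied by x^σ. -/
theorem rpow_sub_rpow_le {σ x y : ℝ} (hσ : 1 ≤ σ) (hy : 0 ≤ y) (hyx : y ≤ x) :
    x ^ σ - y ^ σ ≤ σ * x ^ (σ - 1) * (x - y) := by
  rcases (hy.trans hyx).eq_or_lt with rfl | hx
  · simp [le_antisymm hyx hy]
  have h := one_add_mul_self_le_rpow_one_add (s := y / x - 1)
    (by linarith [div_nonneg hy hx.le]) hσ
  rw [add_sub_cancel, Real.div_rpow hy hx.le, le_div_iff₀ (by positivity)] at h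
  have e : x ^ σ = x ^ (σ - 1) * x := by
    rw [← Real.rpow_add_one hx.ne', sub_add_cancel]
  have e2 : (1 + σ * (y / x - 1)) * x ^ σ = x ^ σ - σ * x ^ (σ - 1) * (x - y) := by
    rw [e]
    field_simp
    ring
  linarith

theorem abs_rpow_sub_rpow_le {σ x y : ℝ} (hσ : 1 ≤ σ) (hx : 0 ≤ x) (hy : 0 ≤ y) :
    |x ^ σ - y ^ σ| ≤ σ * (x + y) ^ (σ - 1) * |x - y| := by
  wlog hyx : y ≤ x generalizing x y
  · have := this hy hx (le_of_not_ge hyx)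
    rwa [abs_sub_comm, abs_sub_comm x, add_comm x]
  rw [abs_of_nonneg (sub_nonneg.2 (Real.rpow_le_rpow hy hyx (by linarith))),
    abs_of_nonneg (sub_nonneg.2 hyx)]
  refine (rpow_sub_rpow_le hσ hy hyx).trans ?_
  have : x ^ (σ - 1) ≤ (x + y) ^ (σ - 1) := Real.rpow_le_rpow hx (by linarith) (by linarith)
  have : 0 ≤ x - y := sub_nonneg.2 hyx
  gcongr

/-- For |b| ≤ |a| the difference is |a|^{σ-1}(a - b) + (|a|^{σ-1} - |b|^{σ-1})b. The second term is
at most |a|^σ - |b|^σ in norm, which avoids differentiating the power σ - 1, singular at 0 for 1 < σ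
< 2. -/
theorem norm_rpow_mul_sub_rpow_mul_le {σ : ℝ} (hσ : 1 ≤ σ) (a b : ℂ) :
    ‖((‖a‖ ^ (σ - 1) : ℝ) : ℂ) * a - ((‖b‖ ^ (σ - 1) : ℝ) : ℂ) * b‖ ≤
      (σ + 1) * (‖a‖ + ‖b‖) ^ (σ - 1) * ‖a - b‖ := by
  wlog hba : ‖b‖ ≤ ‖a‖ generalizing a b
  · have := this b a (le_of_not_ge hba)
    rwa [norm_sub_rev, norm_sub_rev a, add_comm ‖a‖]
  set x := ‖a‖ with hx
  set y := ‖b‖ with hy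
  have hx0 : 0 ≤ x := norm_nonneg a
  have hy0 : 0 ≤ y := norm_nonneg b
  have h1 : ((x ^ (σ - 1) : ℝ) : ℂ) * a - ((y ^ (σ - 1) : ℝ) : ℂ) * b =
      ((x ^ (σ - 1) : ℝ) : ℂ) * (a - b) + ((x ^ (σ - 1) - y ^ (σ - 1) : ℝ) : ℂ) * b := by
    push_cast
    ring
  have hmono : y ^ (σ - 1) ≤ x ^ (σ - 1) := Real.rpow_le_rpow hy0 hba (by linarith)
  have hpow : ∀ z : ℝ, 0 ≤ z → z ^ (σ - 1) * z = z ^ σ := by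
    intro z hz
    nth_rewrite 2 [← Real.rpow_one z]
    rw [← Real.rpow_add' hz (by linarith), sub_add_cancel]
  have h2 : (x ^ (σ - 1) - y ^ (σ - 1)) * y ≤ σ * x ^ (σ - 1) * ‖a - b‖ := by
    have h3 : x - y ≤ ‖a - b‖ := norm_sub_norm_le a b
    calc (x ^ (σ - 1) - y ^ (σ - 1)) * y = x ^ (σ - 1) * y - y ^ σ := by rw [sub_mul, hpow y hy0]
      _ ≤ x ^ (σ - 1) * x - y ^ σ := by gcongr
      _ = x ^ σ - y ^ σ := by rw [hpow x hx0]
      _ ≤ σ * x ^ (σ - 1) * (x - y) := rpow_sub_rpow_le hσ hy0 hba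
      _ ≤ _ := by gcongr
  have hle : x ^ (σ - 1) ≤ (x + y) ^ (σ - 1) :=
    Real.rpow_le_rpow hx0 (by linarith) (by linarith)
  calc _ ≤ x ^ (σ - 1) * ‖a - b‖ + (x ^ (σ - 1) - y ^ (σ - 1)) * y := by
        rw [h1]
        refine (norm_add_le _ _).trans_eq ?_
        rw [norm_mul, norm_mul, Complex.norm_real, Complex.norm_real,
          Real.norm_of_nonneg (by positivity), Real.norm_of_nonneg (sub_nonneg.2 hmono)]
    _ ≤ (σ + 1) * x ^ (σ - 1) * ‖a - b‖ := by linarith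
    _ ≤ _ := by gcongr

theorem enorm_rpow_mul_sub_rpow_mul_le {σ : ℝ} (hσ : 1 ≤ σ) (a b : ℂ) :
    ‖((‖a‖ ^ (σ - 1) : ℝ) : ℂ) * a - ((‖b‖ ^ (σ - 1) : ℝ) : ℂ) * b‖ₑ ≤
      ENNReal.ofReal (σ + 1) * ((‖a‖ₑ + ‖b‖ₑ) ^ (σ - 1) * ‖a - b‖ₑ) := by
  have h := ENNReal.ofReal_le_ofReal (norm_rpow_mul_sub_rpow_mul_le hσ a b)
  rwa [ofReal_norm, mul_assoc, ENNReal.ofReal_mul (by linarith), ENNReal.ofReal_mul (by positivity),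
    ← ENNReal.ofReal_rpow_of_nonneg (by positivity) (by linarith),
    ENNReal.ofReal_add (norm_nonneg a) (norm_nonneg b), ofReal_norm, ofReal_norm, ofReal_norm] at h

theorem enorm_ofReal_rpow_sub_le {σ : ℝ} (hσ : 0 ≤ σ) (a b : ℂ) :
    ‖((‖a‖ ^ (σ + 1) : ℝ) : ℂ) - ((‖b‖ ^ (σ + 1) : ℝ) : ℂ)‖ₑ ≤
      ENNReal.ofReal (σ + 1) * (‖a - b‖ₑ * (‖a‖ₑ + ‖b‖ₑ) ^ σ) := by
  have h := abs_rpow_sub_rpow_le (σ := σ + 1) (by linarith) (norm_nonneg a) (norm_nonneg b)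
  rw [add_sub_cancel_right] at h
  have h' : ‖((‖a‖ ^ (σ + 1) : ℝ) : ℂ) - ((‖b‖ ^ (σ + 1) : ℝ) : ℂ)‖ ≤
      (σ + 1) * (‖a - b‖ * (‖a‖ + ‖b‖) ^ σ) := by
    rw [← Complex.ofReal_sub, Complex.norm_real, Real.norm_eq_abs]
    refine h.trans ?_
    rw [mul_comm ‖a - b‖, ← mul_assoc]
    gcongr
    exact abs_norm_sub_norm_le a b
  have h := ENNReal.ofReal_le_ofReal h'
  rwa [ofReal_norm, ENNReal.ofReal_mul (by linarith), ENNReal.ofReal_mul (by positivity),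
    ← ENNReal.ofReal_rpow_of_nonneg (by positivity) hσ,
    ENNReal.ofReal_add (norm_nonneg a) (norm_nonneg b), ofReal_norm, ofReal_norm, ofReal_norm] at h

theorem enorm_ofReal_norm_rpow {s : ℝ} (hs : 0 ≤ s) (a : ℂ) :
    ‖((‖a‖ ^ s : ℝ) : ℂ)‖ₑ = ‖a‖ₑ ^ s := by
  rw [← ofReal_norm, Complex.norm_real, Real.norm_of_nonneg (by positivity),
    ← ENNReal.ofReal_rpow_of_nonneg (norm_nonneg _) hs, ofReal_norm]

end Pointwise

/-! ### Hölder's inequality in terms of norms. -/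

section LebesgueNorm

variable {X : Type*} [MeasurableSpace X] {μ : Measure X}

/-- Hölder's inequality for the product of a function and powers of two other ones. -/
theorem lintegral_mul_rpow_mul_rpow_rpow_le {f g h : X → ℝ≥0∞} (hf : AEMeasurable f μ)
    (hg : AEMeasurable g μ) (hh : AEMeasurable h μ) {s q r β γ : ℝ} (hs : 0 < s) (hq : 0 < q)
    (hr : 0 < r) (hβ : 0 ≤ β) (hγ : 0 ≤ γ) (hsum : 1 / s = 1 / q + β / r + γ / r) :
    (∫⁻ x, (f x * g x ^ β * h x ^ γ) ^ s ∂μ) ^ (1 / s) ≤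
      (∫⁻ x, f x ^ q ∂μ) ^ (1 / q) * ((∫⁻ x, g x ^ r ∂μ) ^ (1 / r)) ^ β *
        ((∫⁻ x, h x ^ r ∂μ) ^ (1 / r)) ^ γ := by
  have key := lintegral_mul_mul_norm_pow_le (μ := μ) (hf.pow_const q) (hg.pow_const r)
    (hh.pow_const r) (a := s / q) (b := β * s / r) (c := γ * s / r) (by positivity) (by positivity)
    (by positivity) (by
      calc s / q + β * s / r + γ * s / r = s * (1 / q + β / r + γ / r) := by ring
        _ = 1 := by rw [← hsum, mul_one_div_cancel hs.ne'])
  have e : ∀ x, (f x ^ q) ^ (s / q) * (g x ^ r) ^ (β * s / r) * (h x ^ r) ^ (γ * s / r) =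
      (f x * g x ^ β * h x ^ γ) ^ s := by
    intro x
    rw [ENNReal.mul_rpow_of_nonneg _ _ hs.le, ENNReal.mul_rpow_of_nonneg _ _ hs.le]
    simp_rw [← ENNReal.rpow_mul]
    rw [mul_div_cancel₀ s hq.ne', mul_div_cancel₀ (β * s) hr.ne', mul_div_cancel₀ (γ * s) hr.ne']
  simp_rw [e] at key
  refine (ENNReal.rpow_le_rpow key (show 0 ≤ 1 / s by positivity)).trans_eq ?_
  rw [ENNReal.mul_rpow_of_nonneg _ _ (by positivity), ENNReal.mul_rpow_of_nonneg _ _ (by positivity)]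
  simp_rw [← ENNReal.rpow_mul]
  rw [show s / q * (1 / s) = 1 / q by field_simp, show β * s / r * (1 / s) = 1 / r * β by field_simp,
    show γ * s / r * (1 / s) = 1 / r * γ by field_simp]

theorem lintegral_mul_rpow_rpow_le {f g : X → ℝ≥0∞} (hf : AEMeasurable f μ)
    (hg : AEMeasurable g μ) {s q r β : ℝ} (hs : 0 < s) (hq : 0 < q)
    (hr : 0 < r) (hβ : 0 ≤ β) (hsum : 1 / s = 1 / q + β / r) :
    (∫⁻ x, (f x * g x ^ β) ^ s ∂μ) ^ (1 / s) ≤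
      (∫⁻ x, f x ^ q ∂μ) ^ (1 / q) * ((∫⁻ x, g x ^ r ∂μ) ^ (1 / r)) ^ β := by
  have := lintegral_mul_rpow_mul_rpow_rpow_le hf hg hg hs hq hr hβ le_rfl
    (show 1 / s = 1 / q + β / r + 0 / r by rw [hsum, zero_div, add_zero])
  simpa using this

theorem eLpNorm_ofReal_eq {E : Type*} [NormedAddCommGroup E] {p : ℝ} (hp : 0 < p) (f : X → E) :
    eLpNorm f (ENNReal.ofReal p) μ = (∫⁻ x, ‖f x‖ₑ ^ p ∂μ) ^ (1 / p) := by
  rw [eLpNorm_eq_lintegral_rpow_enorm_toReal (by simpa using hp) ENNReal.ofReal_ne_top,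
    ENNReal.toReal_ofReal hp.le]

end LebesgueNorm

/-! ### Lipschitz estimate for the nonlinearity and choice of r. -/

section Nonlinearity

variable {N : ℕ} {α σ r : ℝ}

/-- The exponents for which the nonlinearity maps `Lʳ` to its dual. -/
structure AdmissibleExponent (N : ℕ) (σ r : ℝ) : Prop where
  one_le : 1 ≤ σ
  add_one_lt : σ + 1 < r
  lt_two_mul : r < 2 * (σ + 1)
  mul_lt : 2 * N * (σ + 1) < r * (N + 2)

namespace AdmissibleExponent

theorem pos (h : AdmissibleExponent N σ r) : 0 < r := by
  linarith [h.one_le, h.add_one_lt]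

/-- The source lies in the first of these spaces when v is in Lʳ. The bounds r < 2(σ+1) and 2N(σ+1)
< r(N+2) say precisely that the second exponent q satisfies q > 2 and (N-2)q < 2N, as the resolvent
bound requires. -/
theorem holderConjugate (h : AdmissibleExponent N σ r) :
    (r / (σ + 1)).HolderConjugate (r / (r - (σ + 1))) := by
  have h1 := h.one_le
  have h2 := h.add_one_lt
  have h3 := h.pos
  rw [Real.holderConjugate_iff]
  refine ⟨by rw [one_lt_div (by linarith)]; exact h2, ?_⟩
  rw [inv_div, inv_div, ← add_div, add_sub_cancel, div_self h3.ne']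

theorem two_lt (h : AdmissibleExponent N σ r) : 2 < r / (r - (σ + 1)) := by
  rw [lt_div_iff₀ (by linarith [h.add_one_lt])]
  linarith [h.lt_two_mul]

theorem subcritical (h : AdmissibleExponent N σ r) :
    ((N : ℝ) - 2) * (r / (r - (σ + 1))) < 2 * N := by
  rw [← mul_div_assoc, div_lt_iff₀ (by linarith [h.add_one_lt])]
  linarith [h.mul_lt]

end AdmissibleExponent

theorem measurable_source {v : EuclideanSpace ℝ (Fin N) → ℂ} (hv : Measurable v) :
    Measurable (source σ v) := by
  unfold source
  fun_prop

theorem lintegral_enorm_source_rpow (h : AdmissibleExponent N σ r)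
    (v : EuclideanSpace ℝ (Fin N) → ℂ) :
    ∫⁻ x, ‖source σ v x‖ₑ ^ (r / (σ + 1)) = ∫⁻ x, ‖v x‖ₑ ^ r := by
  have h1 := h.one_le
  refine lintegral_congr fun x => ?_
  rw [source, enorm_ofReal_norm_rpow (by linarith), ← ENNReal.rpow_mul,
    mul_div_cancel₀ _ (by linarith)]

theorem isHelmholtzSolution_helmholtzConv_source (hα : 0 < α) (h : AdmissibleExponent N σ r)
    {v : EuclideanSpace ℝ (Fin N) → ℂ} (hv : Measurable v) (hvr : ∫⁻ x, ‖v x‖ₑ ^ r < ∞) :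
    IsHelmholtzSolution α (source σ v) (helmholtzConv α (source σ v)) :=
  isHelmholtzSolution_helmholtzConv hα h.holderConjugate h.two_lt h.subcritical
    (measurable_source hv) (by rwa [lintegral_enorm_source_rpow h])

theorem isHelmholtzSolution_helmholtzInv {g u : EuclideanSpace ℝ (Fin N) → ℂ}
    (h : IsHelmholtzSolution α g u) : IsHelmholtzSolution α g (helmholtzInv α g) := by
  have h' : ∃ u, IsHelmholtzSolution α g u := ⟨u, h⟩
  rw [helmholtzInv, dif_pos h']
  exact h'.choose_spec

/-- Uniqueness lets estimates for the explicit convolution be used for the solution picked by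
choice. -/
theorem helmholtzInv_ae_eq {g u : EuclideanSpace ℝ (Fin N) → ℂ}
    (h : IsHelmholtzSolution α g u) : helmholtzInv α g =ᵐ[volume] u :=
  (isHelmholtzSolution_helmholtzInv h).ae_eq h

theorem helmholtzLConv_source_lt_top_ae (hα : 0 < α) (h : AdmissibleExponent N σ r)
    {v : EuclideanSpace ℝ (Fin N) → ℂ} (hv : Measurable v) (hvr : ∫⁻ x, ‖v x‖ₑ ^ r < ∞) :
    ∀ᵐ x, helmholtzLConv α (fun y => ‖source σ v y‖ₑ) x < ∞ := by
  have hq : 0 < r / (r - (σ + 1)) := by linarith [h.two_lt]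
  have hm := (measurable_source (σ := σ) hv).enorm
  have hfin := lintegral_helmholtzLConv_rpow_lt_top hα h.holderConjugate h.two_lt
    (by simpa using h.subcritical) hm (by rwa [lintegral_enorm_source_rpow h])
  filter_upwards [ae_lt_top ((measurable_helmholtzLConv α hm).pow_const _) hfin.ne] with x hx
  exact (ENNReal.rpow_lt_top_iff_of_pos hq).1 hx

theorem helmholtzLConv_mono {f g : EuclideanSpace ℝ (Fin N) → ℝ≥0∞} (hfg : ∀ x, f x ≤ g x)
    (x : EuclideanSpace ℝ (Fin N)) : helmholtzLConv α f x ≤ helmholtzLConv α g x :=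
  lintegral_mono fun y => mul_le_mul_right (hfg y) _

theorem helmholtzLConv_const_mul {c : ℝ≥0∞} (hc : c ≠ ∞) (f : EuclideanSpace ℝ (Fin N) → ℝ≥0∞)
    (x : EuclideanSpace ℝ (Fin N)) :
    helmholtzLConv α (fun y => c * f y) x = c * helmholtzLConv α f x := by
  rw [helmholtzLConv, helmholtzLConv, ← lintegral_const_mul' _ _ hc]
  refine lintegral_congr fun y => ?_
  ring

/-- With f(vᵢ) = uᵢwᵢ, the difference is u₁(w₁ - w₂) + (u₁ - u₂)w₂, and |v₁| + |v₂| dominates every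
undifferenced factor. The product m · m^σ and the exponent `(1 : ℝ)` are kept in the shape of the
Hölder lemmas applied to them. -/
theorem enorm_nonlinearity_sub_le_ae (hα : 0 < α) (h : AdmissibleExponent N σ r)
    {v₁ v₂ : EuclideanSpace ℝ (Fin N) → ℂ} (hv₁ : Measurable v₁) (hv₂ : Measurable v₂)
    (hvr₁ : ∫⁻ x, ‖v₁ x‖ₑ ^ r < ∞) (hvr₂ : ∫⁻ x, ‖v₂ x‖ₑ ^ r < ∞) :
    ∀ᵐ x, ‖(nonlinearity α σ v₁ - nonlinearity α σ v₂) x‖ₑ ≤ ENNReal.ofReal (σ + 1) *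
      (helmholtzLConv α (fun y => (‖v₁ y‖ₑ + ‖v₂ y‖ₑ) * (‖v₁ y‖ₑ + ‖v₂ y‖ₑ) ^ σ) x *
          (‖v₁ x‖ₑ + ‖v₂ x‖ₑ) ^ (σ - 1) * ‖v₁ x - v₂ x‖ₑ ^ (1 : ℝ) +
        helmholtzLConv α (fun y => ‖v₁ y - v₂ y‖ₑ * (‖v₁ y‖ₑ + ‖v₂ y‖ₑ) ^ σ) x *
          (‖v₁ x‖ₑ + ‖v₂ x‖ₑ) ^ σ) := by
  have hσ := h.one_le
  filter_upwards [helmholtzInv_ae_eq (isHelmholtzSolution_helmholtzConv_source hα h hv₁ hvr₁),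
    helmholtzInv_ae_eq (isHelmholtzSolution_helmholtzConv_source hα h hv₂ hvr₂),
    helmholtzLConv_source_lt_top_ae hα h hv₁ hvr₁,
    helmholtzLConv_source_lt_top_ae hα h hv₂ hvr₂] with x e₁ e₂ f₁ f₂
  set u₁ := helmholtzConv α (source σ v₁) x
  set u₂ := helmholtzConv α (source σ v₂) x
  have hu₁ : ‖u₁‖ₑ ≤ helmholtzLConv α
      (fun y => (‖v₁ y‖ₑ + ‖v₂ y‖ₑ) * (‖v₁ y‖ₑ + ‖v₂ y‖ₑ) ^ σ) x := by
    refine (enorm_helmholtzConv_le α _ x).trans (helmholtzLConv_mono (fun y => ?_) x)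
    rw [source, enorm_ofReal_norm_rpow (by linarith), add_comm σ,
      ENNReal.rpow_add_of_nonneg _ _ one_pos.le (by linarith), ENNReal.rpow_one]
    exact mul_le_mul' le_self_add (ENNReal.rpow_le_rpow le_self_add (by linarith))
  have hu : ‖u₁ - u₂‖ₑ ≤ ENNReal.ofReal (σ + 1) * helmholtzLConv α
      (fun y => ‖v₁ y - v₂ y‖ₑ * (‖v₁ y‖ₑ + ‖v₂ y‖ₑ) ^ σ) x := by
    refine (enorm_helmholtzConv_sub_le (measurable_source hv₁) (measurable_source hv₂) f₁ f₂).trans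
      ?_
    rw [← helmholtzLConv_const_mul ENNReal.ofReal_ne_top]
    exact helmholtzLConv_mono (fun y => enorm_ofReal_rpow_sub_le (by linarith) _ _) x
  have hw := enorm_rpow_mul_sub_rpow_mul_le hσ (v₁ x) (v₂ x)
  set w₁ := ((‖v₁ x‖ ^ (σ - 1) : ℝ) : ℂ) * v₁ x with hw₁
  set w₂ := ((‖v₂ x‖ ^ (σ - 1) : ℝ) : ℂ) * v₂ x with hw₂
  have hw2 : ‖w₂‖ₑ ≤ (‖v₁ x‖ₑ + ‖v₂ x‖ₑ) ^ σ := by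
    rw [hw₂, enorm_mul, enorm_ofReal_norm_rpow (by linarith)]
    nth_rewrite 2 [← ENNReal.rpow_one ‖v₂ x‖ₑ]
    rw [← ENNReal.rpow_add_of_nonneg _ _ (by linarith) one_pos.le, sub_add_cancel]
    exact ENNReal.rpow_le_rpow le_add_self (by linarith)
  have e : (nonlinearity α σ v₁ - nonlinearity α σ v₂) x = u₁ * (w₁ - w₂) + (u₁ - u₂) * w₂ := by
    rw [Pi.sub_apply, nonlinearity, nonlinearity, e₁, e₂, mul_assoc, mul_assoc]
    ring
  rw [e]
  refine (enorm_add_le _ _).trans ?_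
  rw [enorm_mul, enorm_mul]
  refine (add_le_add (mul_le_mul' hu₁ hw) (mul_le_mul' hu hw2)).trans_eq ?_
  rw [ENNReal.rpow_one]
  ring

/-- The nonlinearity is locally Lipschitz from `Lʳ` to its dual. -/
theorem exists_eLpNorm_nonlinearity_sub_le (hα : 0 < α) (h : AdmissibleExponent N σ r) :
    ∃ C : ℝ≥0, ∀ v₁ v₂ : EuclideanSpace ℝ (Fin N) → ℂ, Measurable v₁ → Measurable v₂ →
      MemLp v₁ (ENNReal.ofReal r) → MemLp v₂ (ENNReal.ofReal r) →
        eLpNorm (nonlinearity α σ v₁ - nonlinearity α σ v₂) (ENNReal.ofReal (r / (r - 1))) volume ≤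
          C * (eLpNorm v₁ (ENNReal.ofReal r) volume + eLpNorm v₂ (ENNReal.ofReal r) volume) ^
            (2 * σ) * eLpNorm (v₁ - v₂) (ENNReal.ofReal r) volume := by
  have hσ := h.one_le
  have hr := h.pos
  have hr1 : 1 < r := by linarith [h.add_one_lt]
  set p := r / (σ + 1) with hp
  set q := r / (r - (σ + 1)) with hq
  set s := r / (r - 1) with hs
  have hpq : p.HolderConjugate q := h.holderConjugate
  have hp0 : 0 < p := hpq.pos
  have hq2 : 2 < q := h.two_lt
  have hq0 : 0 < q := by linarith
  have hs0 : 0 < s := div_pos hr (by linarith)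
  have hs1 : 1 ≤ s := by rw [hs, one_le_div (by linarith)]; linarith
  -- Here s is the conjugate of r: a convolution in L^q times σ factors in Lʳ. The next identity is
  -- the analogous count for the sources, of σ + 1 factors in Lʳ giving Lᵖ.
  have hsq : 1 / s = 1 / q + σ / r := by
    rw [hs, hq, one_div_div, one_div_div, ← add_div]
    congr 1
    ring
  have hpr : 1 / p = 1 / r + σ / r := by
    rw [hp, one_div_div, ← add_div, add_comm]
  set A : ℝ≥0∞ := ((∫⁻ z : EuclideanSpace ℝ (Fin N),
    helmholtzKernel α z ^ (q / 2)) ^ (1 / q)) ^ 2 with hA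
  have hAtop : A ≠ ∞ := by
    refine ENNReal.pow_ne_top (ENNReal.rpow_ne_top_of_nonneg (by positivity) (LT.lt.ne ?_))
    refine lintegral_helmholtzKernel_rpow_lt_top hα (by linarith) ?_
    rw [finrank_euclideanSpace_fin]
    linarith [h.subcritical]
  refine ⟨(ENNReal.ofReal (σ + 1) * (2 * A)).toNNReal, fun v₁ v₂ hv₁ hv₂ hL₁ hL₂ => ?_⟩
  rw [ENNReal.coe_toNNReal (by finiteness)]
  have hvr₁ := (memLp_ofReal_iff hr hv₁.aestronglyMeasurable).1 hL₁
  have hvr₂ := (memLp_ofReal_iff hr hv₂.aestronglyMeasurable).1 hL₂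
  set m : EuclideanSpace ℝ (Fin N) → ℝ≥0∞ := fun x => ‖v₁ x‖ₑ + ‖v₂ x‖ₑ with hm
  set d : EuclideanSpace ℝ (Fin N) → ℝ≥0∞ := fun x => ‖v₁ x - v₂ x‖ₑ with hd
  have hmm : Measurable m := by fun_prop
  have hdm : Measurable d := by fun_prop
  set M : ℝ≥0∞ := (∫⁻ x, m x ^ r) ^ (1 / r) with hM
  set D : ℝ≥0∞ := (∫⁻ x, d x ^ r) ^ (1 / r) with hD
  have hDeq : eLpNorm (v₁ - v₂) (ENNReal.ofReal r) volume = D := eLpNorm_ofReal_eq hr _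
  have hMle : M ≤ eLpNorm v₁ (ENNReal.ofReal r) volume + eLpNorm v₂ (ENNReal.ofReal r) volume := by
    rw [eLpNorm_ofReal_eq hr, eLpNorm_ofReal_eq hr]
    exact ENNReal.lintegral_Lp_add_le hv₁.enorm.aemeasurable hv₂.enorm.aemeasurable hr1.le
  set L₁ := helmholtzLConv α fun y => m y * m y ^ σ with hL₁'
  set L₂ := helmholtzLConv α fun y => d y * m y ^ σ with hL₂'
  have hL₁m : Measurable L₁ := measurable_helmholtzLConv α (by fun_prop)
  have hL₂m : Measurable L₂ := measurable_helmholtzLConv α (by fun_prop)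
  have hb₁ : (∫⁻ x, L₁ x ^ q) ^ (1 / q) ≤ A * (M * M ^ σ) :=
    (lintegral_helmholtzLConv_rpow_rpow_le hpq hq2.le (by fun_prop)).trans
      (mul_le_mul_right (lintegral_mul_rpow_rpow_le hmm.aemeasurable hmm.aemeasurable hp0 hr hr
        (by linarith) hpr) _)
  have hb₂ : (∫⁻ x, L₂ x ^ q) ^ (1 / q) ≤ A * (D * M ^ σ) :=
    (lintegral_helmholtzLConv_rpow_rpow_le hpq hq2.le (by fun_prop)).trans
      (mul_le_mul_right (lintegral_mul_rpow_rpow_le hdm.aemeasurable hmm.aemeasurable hp0 hr hr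
        (by linarith) hpr) _)
  -- In this term the difference d is outside the convolution; in the second one it is inside. Both
  -- give 2σ powers of M and one of D, hence the factor 2 in the constant.
  have hc₁ : (∫⁻ x, (L₁ x * m x ^ (σ - 1) * d x ^ (1 : ℝ)) ^ s) ^ (1 / s) ≤
      A * M ^ (2 * σ) * D := by
    refine (lintegral_mul_rpow_mul_rpow_rpow_le hL₁m.aemeasurable hmm.aemeasurable hdm.aemeasurable
      hs0 hq0 hr (by linarith) one_pos.le (by rw [hsq]; ring)).trans ?_
    refine (mul_le_mul_left (mul_le_mul_left hb₁ _) _).trans_eq ?_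
    have : M ^ (2 * σ) = M * M ^ σ * M ^ (σ - 1) := by
      nth_rewrite 2 [← ENNReal.rpow_one M]
      rw [← ENNReal.rpow_add_of_nonneg _ _ one_pos.le (by linarith),
        ← ENNReal.rpow_add_of_nonneg _ _ (by linarith) (by linarith)]
      congr 1
      ring
    rw [ENNReal.rpow_one, this]
    ring
  have hc₂ : (∫⁻ x, (L₂ x * m x ^ σ) ^ s) ^ (1 / s) ≤ A * M ^ (2 * σ) * D := by
    refine (lintegral_mul_rpow_rpow_le hL₂m.aemeasurable hmm.aemeasurable hs0 hq0 hr (by linarith)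
      hsq).trans ?_
    refine (mul_le_mul_left hb₂ _).trans_eq ?_
    rw [two_mul, ENNReal.rpow_add_of_nonneg _ _ (by linarith) (by linarith)]
    ring
  calc eLpNorm (nonlinearity α σ v₁ - nonlinearity α σ v₂) (ENNReal.ofReal s) volume
      = (∫⁻ x, ‖(nonlinearity α σ v₁ - nonlinearity α σ v₂) x‖ₑ ^ s) ^ (1 / s) :=
        eLpNorm_ofReal_eq hs0 _
    _ ≤ (∫⁻ x, (ENNReal.ofReal (σ + 1) *
          (L₁ x * m x ^ (σ - 1) * d x ^ (1 : ℝ) + L₂ x * m x ^ σ)) ^ s) ^ (1 / s) := by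
        refine ENNReal.rpow_le_rpow (lintegral_mono_ae ?_) (by positivity)
        filter_upwards [enorm_nonlinearity_sub_le_ae hα h hv₁ hv₂ hvr₁ hvr₂] with x hx
        exact ENNReal.rpow_le_rpow hx hs0.le
    _ = ENNReal.ofReal (σ + 1) *
          (∫⁻ x, (L₁ x * m x ^ (σ - 1) * d x ^ (1 : ℝ) + L₂ x * m x ^ σ) ^ s) ^ (1 / s) := by
        simp_rw [ENNReal.mul_rpow_of_nonneg _ _ hs0.le]
        rw [lintegral_const_mul' _ _ (by finiteness), ENNReal.mul_rpow_of_nonneg _ _ (by positivity),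
          ← ENNReal.rpow_mul, mul_one_div_cancel hs0.ne', ENNReal.rpow_one]
    _ ≤ ENNReal.ofReal (σ + 1) * (A * M ^ (2 * σ) * D + A * M ^ (2 * σ) * D) := by
        refine mul_le_mul_right ?_ _
        exact (ENNReal.lintegral_Lp_add_le (by fun_prop) (by fun_prop) hs1).trans
          (add_le_add hc₁ hc₂)
    _ = ENNReal.ofReal (σ + 1) * (2 * A) * M ^ (2 * σ) * D := by ring
    _ ≤ _ := by
        rw [hDeq]
        gcongr

/-- The Lipschitz bound against v₂ = 0 gives finiteness, as the nonlinearity vanishes at 0 whatever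
the value of `helmholtzInv` there. -/
theorem memLp_nonlinearity (hα : 0 < α) (h : AdmissibleExponent N σ r)
    {v : EuclideanSpace ℝ (Fin N) → ℂ} (hv : Measurable v) (hvr : MemLp v (ENNReal.ofReal r)) :
    MemLp (nonlinearity α σ v) (ENNReal.ofReal (r / (r - 1))) := by
  refine ⟨?_, ?_⟩
  · have hu := helmholtzInv_ae_eq (isHelmholtzSolution_helmholtzConv_source hα h hv
      ((memLp_ofReal_iff h.pos hv.aestronglyMeasurable).1 hvr))
    have hum : AEStronglyMeasurable (helmholtzInv α (source σ v)) :=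
      (stronglyMeasurable_helmholtzConv α (measurable_source hv)).aestronglyMeasurable.congr hu.symm
    refine (hum.mul ?_).mul hv.aestronglyMeasurable
    exact Measurable.aestronglyMeasurable (by fun_prop)
  · obtain ⟨C, hC⟩ := exists_eLpNorm_nonlinearity_sub_le hα h
    have h0 : nonlinearity α σ (0 : EuclideanSpace ℝ (Fin N) → ℂ) = 0 := by
      ext x
      simp [nonlinearity]
    have := hC v 0 hv measurable_zero hvr MemLp.zero
    rw [h0, sub_zero, sub_zero, eLpNorm_zero, add_zero] at this
    refine this.trans_lt ?_
    have := h.one_le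
    exact ENNReal.mul_lt_top (ENNReal.mul_lt_top ENNReal.coe_lt_top
      (ENNReal.rpow_lt_top_of_nonneg (by linarith) hvr.2.ne)) hvr.2

theorem exists_admissibleExponent {N : ℕ} {σ : ℝ} (hN : 1 ≤ N) (hσ : 1 ≤ σ)
    (hσN : 2 < N → σ < 4 / ((N : ℝ) - 2)) :
    ∃ r, 2 < r ∧ ((N : ℝ) - 2) * r < 2 * N ∧ AdmissibleExponent N σ r := by
  rcases le_or_gt N 2 with hN2 | hN2
  · have h1 : (1 : ℝ) ≤ N := by exact_mod_cast hN
    have h2 : (N : ℝ) ≤ 2 := by exact_mod_cast hN2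
    -- For N ≤ 2 the Sobolev constraint is void, and the midpoint of (σ+1, 2(σ+1)) works: the last
    -- condition reduces to N < 6.
    refine ⟨3 / 2 * (σ + 1), by linarith, by nlinarith, hσ, by linarith, by linarith, by nlinarith⟩
  · have h3 : (3 : ℝ) ≤ N := by exact_mod_cast hN2
    have hs := hσN hN2
    rw [lt_div_iff₀ (by linarith)] at hs
    -- The lower bound is below 2N/(N-2) exactly because σ(N-2) < 4, and below 2(σ+1) because N <
    -- N+2. It also forces r > σ+1 ≥ 2, since 2N ≥ N+2.
    obtain ⟨r, hr1, hr2⟩ : ∃ r, 2 * N * (σ + 1) / (N + 2) < r ∧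
        r < min (2 * N / ((N : ℝ) - 2)) (2 * (σ + 1)) := by
      refine exists_between (lt_min ?_ ?_)
      · rw [div_lt_div_iff₀ (by linarith) (by linarith)]
        nlinarith
      · rw [div_lt_iff₀ (by linarith)]
        nlinarith
    rw [lt_min_iff, lt_div_iff₀ (by linarith)] at hr2
    rw [div_lt_iff₀ (by linarith)] at hr1
    have h4 : σ + 1 < r := by
      by_contra! hle
      nlinarith
    exact ⟨r, by linarith, by linarith, hσ, h4, hr2.2, hr1⟩

end Nonlinearity

theorem proposition2 (N : ℕ) (hN : 1 ≤ N) (σ : ℝ) (hσ : 1 ≤ σ)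
    (hσN : 2 < N → σ < 4 / ((N : ℝ) - 2)) :
    ∃ r r' : ℝ, 2 < r ∧ (2 < N → r ≤ 2 * (N : ℝ) / ((N : ℝ) - 2)) ∧ 1 / r + 1 / r' = 1 ∧
      ∀ α : ℝ, 0 < α →
        (∀ v : Lp ℂ 2 (volume : Measure (EuclideanSpace ℝ (Fin N))), MemH1 v →
          MemLp v (ENNReal.ofReal r) volume ∧
          IsHelmholtzSolution α (source σ v) (helmholtzInv α (source σ v)) ∧
          MemLp (nonlinearity α σ v) (ENNReal.ofReal r') volume) ∧
        ∃ C : ℝ≥0, ∀ v₁ v₂ : Lp ℂ 2 (volume : Measure (EuclideanSpace ℝ (Fin N))),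
          MemH1 v₁ → MemH1 v₂ →
            eLpNorm (nonlinearity α σ v₁ - nonlinearity α σ v₂) (ENNReal.ofReal r') volume ≤
              C * (h1Norm v₁ + h1Norm v₂) ^ (2 * σ) *
                eLpNorm (⇑v₁ - ⇑v₂) (ENNReal.ofReal r) volume := by
  obtain ⟨r, hr, hrN, h⟩ := exists_admissibleExponent hN hσ hσN
  obtain ⟨S, hS⟩ := exists_eLpNorm_le_h1Norm (N := N) hr hrN
  have hLr : ∀ v : Lp ℂ 2 (volume : Measure (EuclideanSpace ℝ (Fin N))), MemH1 v →
      MemLp v (ENNReal.ofReal r) volume := fun v hv =>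
    ⟨Lp.aestronglyMeasurable v,
      (hS v).trans_lt (ENNReal.mul_lt_top ENNReal.coe_lt_top ((memH1_iff v).1 hv))⟩
  have hmeas : ∀ v : Lp ℂ 2 (volume : Measure (EuclideanSpace ℝ (Fin N))), Measurable v :=
    fun v => (Lp.stronglyMeasurable v).measurable
  refine ⟨r, r / (r - 1), hr, fun hN2 => ?_, ?_, fun α hα => ⟨fun v hv => ⟨hLr v hv, ?_, ?_⟩, ?_⟩⟩
  · have h3 : (2 : ℝ) < N := by exact_mod_cast hN2
    rw [le_div_iff₀ (by linarith)]
    linarith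
  · rw [one_div_div, ← add_div, add_sub_cancel, div_self (by linarith)]
  · exact isHelmholtzSolution_helmholtzInv (isHelmholtzSolution_helmholtzConv_source hα h (hmeas v)
      ((memLp_ofReal_iff h.pos (hmeas v).aestronglyMeasurable).1 (hLr v hv)))
  · exact memLp_nonlinearity hα h (hmeas v) (hLr v hv)
  · obtain ⟨C, hC⟩ := exists_eLpNorm_nonlinearity_sub_le hα h
    -- The embedding constant S is spent on the 2σ powers only; the difference stays in Lʳ.
    refine ⟨C * S ^ (2 * σ), fun v₁ v₂ hv₁ hv₂ => ?_⟩
    refine (hC v₁ v₂ (hmeas v₁) (hmeas v₂) (hLr v₁ hv₁) (hLr v₂ hv₂)).trans ?_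
    refine mul_le_mul_left ?_ _
    rw [ENNReal.coe_mul, mul_assoc]
    refine mul_le_mul_right ?_ _
    rw [ENNReal.coe_rpow_of_nonneg _ (by linarith), ← ENNReal.mul_rpow_of_nonneg _ _ (by linarith),
      mul_add]
    exact ENNReal.rpow_le_rpow (add_le_add (hS v₁) (hS v₂)) (by linarith)
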